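/- Consider randomized adaptive algorithms that have access to an unknown simple undirected graph $G$ on the vertex set $[n]$ ($n$ is known, the edge set and the number of edges are not) through three kinds of queries: a degree query on a vertex $v$ returns $\deg(v)$; a neighbor query on $v$ returns a fresh uniformly random neighbor of $v$, or a special symbol if $v$ has none; an independent-set (IS) query on $U\subseteq[n]$ returns whether $U$ is an independent set of $G$. For every $\varepsilon_0<1$ there is a constant $c=c(\varepsilon_0)>0$ such that the following holds for all $\varepsilon\in(0,\varepsilon_0]$ and all $n$. Let $\mathcal A$ be any such algorithm which, on every graph $G=([n],E)$, outputs with probability at least $2/3$ a number $\widehat m$ with $(1-\varepsilon)|E|\le\widehat m\le(1+\varepsilon)|E|$. Then for every integer $m$ with $1\le m\le\binom n2$ there is a graph $G$ on $[n]$ with exactly $m$ edges on which the expected number of queries made by $\mathcal A$ is at least \[ c\cdot\min\left(\sqrt m,\ \sqrt{\frac{n}{\varepsilon\sqrt m}}\right). \] -/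

import Mathlib

open scoped ENNReal

namespace HybridModel

/-- A query to a hidden graph on the vertex set `Fin n`. -/
inductive Query (n : ℕ) : Type
  /-- ask for the degree of `v` -/
  | deg (v : Fin n) : Query n
  /-- ask for a uniformly random neighbor of `v` -/
  | neigh (v : Fin n) : Query n
  /-- ask whether `S` is an independent set -/
  | indep (S : Finset (Fin n)) : Query n

/-- An answer to a query. The answer `neigh none` to a neighbor query signifies that the vertex
has no neighbors. -/
inductive Answer (n : ℕ) : Type
  | deg (d : ℕ) : Answer n
  | neigh (v : Option (Fin n)) : Answer n
  | indep (b : Bool) : Answer n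

/-- The finite set of queries carries the discrete sigma-algebra. -/
instance instMeasurableSpaceQuery (n : ℕ) : MeasurableSpace (Query n) := ⊤

open Classical in
/-- The law of a uniformly random neighbor of `v` in `G` (`none` if `v` is isolated). -/
noncomputable def randomNeighbor {n : ℕ} (G : SimpleGraph (Fin n)) (v : Fin n) :
    PMF (Option (Fin n)) :=
  if h : (G.neighborFinset v).Nonempty then
    (PMF.uniformOfFinset (G.neighborFinset v) h).map some
  else PMF.pure none

open Classical in
/-- The law of the oracle's answer to a query, for the hidden graph `G`. Degree and independent
set queries are answered deterministically; each neighbor query is answered by a fresh sample. -/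
noncomputable def oracle {n : ℕ} (G : SimpleGraph (Fin n)) : Query n → PMF (Answer n)
  | .deg v => PMF.pure (.deg (G.degree v))
  | .neigh v => (randomNeighbor G v).map Answer.neigh
  | .indep S => PMF.pure (.indep (decide (G.IsIndepSet (S : Set (Fin n)))))

/-- The history of an execution: the queries made so far with their answers, in order. -/
abbrev History (n : ℕ) : Type := List (Query n × Answer n)

/-- An adaptive deterministic query algorithm: given the history it either makes a further query
(`Sum.inl`) or halts and outputs a real number (`Sum.inr`). It need not always halt. -/
abbrev DetAlg (n : ℕ) : Type := History n → Query n ⊕ ℝ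

/-- The law of the history of `A` on the hidden graph `G` after `t` rounds; in each round an
algorithm that has not halted makes one query. -/
noncomputable def run {n : ℕ} (A : DetAlg n) (G : SimpleGraph (Fin n)) : ℕ → PMF (History n)
  | 0 => PMF.pure []
  | t + 1 => (run A G t).bind fun h =>
      match A h with
      | .inl q => (oracle G q).map fun a => h ++ [(q, a)]
      | .inr _ => PMF.pure h

/-- The expected number of queries of a deterministic algorithm on `G` (over the randomness of the
neighbor oracle): the limit of the expected number of queries made in the first `t` rounds, which
is nondecreasing in `t`. -/
noncomputable def DetAlg.expectedQueries {n : ℕ} (A : DetAlg n) (G : SimpleGraph (Fin n)) :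
    ℝ≥0∞ :=
  ⨆ t : ℕ, ∑' h : History n, run A G t h * (h.length : ℝ≥0∞)

/-- The probability (over the randomness of the neighbor oracle) that a deterministic algorithm
halts on `G` with an output in `S`: the limit of the probabilities that it has done so within the
first `t` rounds, which are nondecreasing in `t`. -/
noncomputable def DetAlg.probOutput {n : ℕ} (A : DetAlg n) (G : SimpleGraph (Fin n))
    (S : Set ℝ) : ℝ≥0∞ :=
  ⨆ t : ℕ, (run A G t).toOuterMeasure {h | ∃ x ∈ S, A h = Sum.inr x}

/-- A randomized query algorithm with random seed in `Ω`: for every seed a deterministic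
algorithm, each of whose decisions depends measurably on the seed. -/
structure RandAlg (n : ℕ) (Ω : Type*) [MeasurableSpace Ω] where
  toDet : Ω → DetAlg n
  measurable_toDet : ∀ h : History n, Measurable fun ω => toDet ω h

/-- The expected number of queries on `G`, over the seed (with law `μ`) and, independently of it,
the randomness of the neighbor oracle. -/
noncomputable def RandAlg.expectedQueries {n : ℕ} {Ω : Type*} [MeasurableSpace Ω]
    (A : RandAlg n Ω) (μ : MeasureTheory.Measure Ω) (G : SimpleGraph (Fin n)) : ℝ≥0∞ :=
  ∫⁻ ω, (A.toDet ω).expectedQueries G ∂μ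

/-- The probability of halting on `G` with an output in `S`, over the seed (with law `μ`) and,
independently of it, the randomness of the neighbor oracle. -/
noncomputable def RandAlg.probOutput {n : ℕ} {Ω : Type*} [MeasurableSpace Ω]
    (A : RandAlg n Ω) (μ : MeasureTheory.Measure Ω) (G : SimpleGraph (Fin n))
    (S : Set ℝ) : ℝ≥0∞ :=
  ∫⁻ ω, (A.toDet ω).probOutput G S ∂μ

/-- On every graph with vertex set `Fin n`, the algorithm outputs, with probability at least
`2 / 3`, a number within a factor `1 ± ε` of the number of edges. -/
def RandAlg.EstimatesEdges {n : ℕ} {Ω : Type*} [MeasurableSpace Ω]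
    (A : RandAlg n Ω) (μ : MeasureTheory.Measure Ω) (ε : ℝ) : Prop :=
  ∀ G : SimpleGraph (Fin n),
    2 / 3 ≤ A.probOutput μ G
      (Set.Icc ((1 - ε) * (G.edgeSet.ncard : ℝ)) ((1 + ε) * (G.edgeSet.ncard : ℝ)))

end HybridModel

/-!
The lower bound comes from pairs of graphs `G`, `G'` such that `G` has `m` edges and no number
estimates the edges of both accurately. Until an algorithm makes a query whose answer has different
laws on `G` and `G'`, it behaves alike on both; so if it is likely to be correct on both, it either
makes such a query within `q` rounds or is still running after them with probability at least
`1 / 4`. By averaging, it is enough to give a finite family of pairs such that each deterministic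
algorithm makes such a query with average probability at most `1 / 12`.

Let `k + 1` be the size of the largest clique with at most `m` edges, so that `k` is about
`√(2 * m)`.

If `n < 6 * (k + 1)`, let `G` contain a clique on `k + 1` vertices, and obtain `G'` by removing all
edges inside one of `12 * q` disjoint sets of clique vertices. Each query can detect the removal for
at most one of these sets.

If `6 * (k + 1) ≤ n`, let `G` consist of a clique with one hidden vertex `x i` in each of `k + 1`
blocks, and of a matching that makes up the number of edges. Obtain `G'` by planting a complete
bipartite graph between one of many disjoint sets of block vertices and one of `36 * q` disjoint
sets of further vertices. Degree and neighbor queries rarely meet these sets. An independent-set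
query reveals something only if its set is independent in `G`, and then this set contains at most
one clique vertex. So `q` queries expose a set of block vertices that contains at most `q` clique
vertices. By a Chernoff bound, a given set of `12 * q * b` block vertices, where `b` is the size of
a block, contains so few of them with probability exponentially small in `q`, and this survives a
union bound over the histories: if the random neighbors are selected by seeds, which refer to the
blocks, and the hidden vertices of the at most `2 * q` blocks that the seeds refer to are fixed,
then each query has only two possible answers.
-/

namespace HybridModel

section ProbabilityMassFunctions

variable {α : Type*} (p : PMF α)

lemma toOuterMeasure_univ : p.toOuterMeasure Set.univ = 1 :=
  (p.toOuterMeasure_apply_eq_one_iff _).mpr (Set.subset_univ _)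

lemma toOuterMeasure_add_le_one {s t : Set α} (hst : Disjoint s t) :
    p.toOuterMeasure s + p.toOuterMeasure t ≤ 1 := by
  rw [PMF.toOuterMeasure_apply, PMF.toOuterMeasure_apply, ← ENNReal.tsum_add, ← p.tsum_coe]
  refine ENNReal.tsum_le_tsum fun a => ?_
  calc s.indicator p a + t.indicator p a = (s ∪ t).indicator p a :=
        (congrFun (Set.indicator_union_of_disjoint hst p) a).symm
    _ ≤ p a := Set.indicator_le_self _ _ _

lemma one_le_toOuterMeasure_add {s t : Set α} (hst : s ∪ t = Set.univ) :
    1 ≤ p.toOuterMeasure s + p.toOuterMeasure t :=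
  calc 1 = p.toOuterMeasure (s ∪ t) := by rw [hst, toOuterMeasure_univ]
    _ ≤ _ := MeasureTheory.measure_union_le s t

lemma sum_toOuterMeasure_le {ι : Type*} [Fintype ι] (E : ι → Set α) {c : ℝ≥0∞}
    (h : ∀ a ∈ p.support, ({i | a ∈ E i}.ncard : ℝ≥0∞) ≤ c) :
    ∑ i, p.toOuterMeasure (E i) ≤ c := by
  classical
  have hcount (a : α) : ∑ i, (E i).indicator (⇑p) a = p a * {i | a ∈ E i}.ncard := by
    simp only [Set.indicator_apply, ← Finset.sum_filter, Finset.sum_const, nsmul_eq_mul]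
    rw [mul_comm, Set.ncard_eq_toFinset_card', Set.toFinset_ofPred]
  calc ∑ i, p.toOuterMeasure (E i) = ∑' a, ∑ i, (E i).indicator (⇑p) a := by
        simp only [PMF.toOuterMeasure_apply]
        rw [← Summable.tsum_finsetSum fun _ _ => ENNReal.summable]
    _ ≤ ∑' a, p a * c := by
        refine ENNReal.tsum_le_tsum fun a => ?_
        rw [hcount]
        by_cases ha : a ∈ p.support
        · gcongr
          exact h a ha
        · simp [(PMF.apply_eq_zero_iff _ _).mpr ha]
    _ = c := by rw [ENNReal.tsum_mul_right, p.tsum_coe, one_mul]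

lemma map_eq_pure_of_forall_eq {β : Type*} {f : α → β} {b : β} (h : ∀ a, f a = b) :
    p.map f = PMF.pure b := by
  rw [funext h]
  exact p.map_const b

end ProbabilityMassFunctions

section Rounds

variable {n : ℕ} {A : DetAlg n} {G G' : SimpleGraph (Fin n)}

/-- The law of the history after one further round, starting from the history `h` and the decision
to make a given query or to halt. -/
noncomputable def stepLaw (G : SimpleGraph (Fin n)) (h : History n) :
    Query n ⊕ ℝ → PMF (History n) :=
  Sum.elim (fun q => (oracle G q).map fun a => h ++ [(q, a)]) fun _ => PMF.pure h

/-- The histories at which `A` has halted with an output in `S`. -/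
def haltsIn (A : DetAlg n) (S : Set ℝ) : Set (History n) := {h | ∃ x ∈ S, A h = Sum.inr x}

/-- The histories at which `A` makes a further query. -/
def pending (A : DetAlg n) : Set (History n) := {h | ∃ q, A h = Sum.inl q}

/-- The histories containing a query that the oracles of `G` and `G'` answer with different
laws. -/
def distinguishing (G G' : SimpleGraph (Fin n)) : Set (History n) :=
  {h | ∃ p ∈ h, oracle G p.1 ≠ oracle G' p.1}

lemma run_succ (t : ℕ) :
    run A G (t + 1) = (run A G t).bind fun h => stepLaw G h (A h) := by
  refine congrArg (run A G t).bind (funext fun h => ?_)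
  rcases A h with q | x <;> rfl

lemma length_of_mem_support_run {t : ℕ} {h : History n} (hh : h ∈ (run A G t).support) :
    h.length ≤ t ∧ (h ∈ pending A → h.length = t) := by
  induction t generalizing h with
  | zero => simp_all [run]
  | succ t ih =>
    rw [run_succ, PMF.mem_support_bind_iff] at hh
    obtain ⟨k, hk, hkh⟩ := hh
    rcases hA : A k with q | x <;> rw [hA] at hkh
    · obtain ⟨a, -, rfl⟩ := (PMF.mem_support_map_iff _ _ _).mp hkh
      simp [(ih hk).2 ⟨q, hA⟩]
    · obtain rfl := (PMF.mem_support_pure_iff _ _).mp hkh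
      exact ⟨(ih hk).1.trans (Nat.le_succ t), fun ⟨q, hq⟩ => by simp [hA] at hq⟩

lemma monotone_toOuterMeasure_haltsIn (S : Set ℝ) :
    Monotone fun t => (run A G t).toOuterMeasure (haltsIn A S) := by
  refine monotone_nat_of_le_succ fun t => ?_
  rw [run_succ, PMF.toOuterMeasure_bind_apply, PMF.toOuterMeasure_apply]
  refine ENNReal.tsum_le_tsum fun h => ?_
  by_cases hh : h ∈ haltsIn A S
  · obtain ⟨x, -, hA⟩ := id hh
    simp [hA, stepLaw, hh]
  · simp [hh]

lemma disjoint_haltsIn {S S' : Set ℝ} (hS : Disjoint S S') :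
    Disjoint (haltsIn A S) (haltsIn A S') := by
  rw [Set.disjoint_left]
  rintro h ⟨x, hx, hA⟩ ⟨y, hy, hA'⟩
  obtain rfl : x = y := Sum.inr.inj (hA.symm.trans hA')
  exact Set.disjoint_left.mp hS hx hy

lemma haltsIn_compl_union_union_pending (A : DetAlg n) (S : Set ℝ) :
    haltsIn A Sᶜ ∪ (haltsIn A S ∪ pending A) = Set.univ := by
  refine Set.eq_univ_of_forall fun h => ?_
  rcases hA : A h with q | x
  · exact .inr (.inr ⟨q, hA⟩)
  · by_cases hx : x ∈ S
    · exact .inr (.inl ⟨x, hx, hA⟩)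
    · exact .inl ⟨x, hx, hA⟩

lemma toOuterMeasure_haltsIn_add_probOutput_le_one {S S' : Set ℝ} (hS : Disjoint S S') (q : ℕ) :
    (run A G q).toOuterMeasure (haltsIn A S) + A.probOutput G S' ≤ 1 := by
  rw [DetAlg.probOutput, ENNReal.add_iSup]
  exact iSup_le fun t =>
    (add_le_add (monotone_toOuterMeasure_haltsIn S (le_max_left q t))
      (monotone_toOuterMeasure_haltsIn S' (le_max_right q t))).trans
    (toOuterMeasure_add_le_one _ (disjoint_haltsIn hS))

lemma probOutput_le (S : Set ℝ) (q : ℕ) :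
    A.probOutput G S ≤
      (run A G q).toOuterMeasure (haltsIn A S) + (run A G q).toOuterMeasure (pending A) := by
  have hle : (run A G q).toOuterMeasure (haltsIn A Sᶜ) + A.probOutput G S ≤ 1 :=
    toOuterMeasure_haltsIn_add_probOutput_le_one disjoint_compl_left q
  have hfinite : (run A G q).toOuterMeasure (haltsIn A Sᶜ) ≠ ∞ :=
    ne_top_of_le_ne_top ENNReal.one_ne_top (le_self_add.trans hle)
  have hcover := hle.trans
    (one_le_toOuterMeasure_add (run A G q) (haltsIn_compl_union_union_pending A S))
  exact ((ENNReal.add_le_add_iff_left hfinite).mp hcover).trans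
    (MeasureTheory.measure_union_le _ _)

lemma stepLaw_apply_eq_zero {k h : History n} (hkh : ¬ k <+: h) (s : Query n ⊕ ℝ) :
    stepLaw G k s h = 0 := by
  rw [PMF.apply_eq_zero_iff]
  rcases s with q | x
  · intro hmem
    obtain ⟨a, -, rfl⟩ := (PMF.mem_support_map_iff _ _ _).mp hmem
    exact hkh (List.prefix_append _ _)
  · intro hmem
    obtain rfl := (PMF.mem_support_pure_iff _ _).mp hmem
    exact hkh List.prefix_rfl

lemma stepLaw_apply_eq_of_notMem_distinguishing {h : History n} (hh : h ∉ distinguishing G G')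
    (k : History n) (s : Query n ⊕ ℝ) : stepLaw G k s h = stepLaw G' k s h := by
  rcases s with q | x
  · by_cases hmem : ∃ a, k ++ [(q, a)] = h
    · obtain ⟨a, rfl⟩ := hmem
      have horacle : oracle G q = oracle G' q := by
        by_contra hne
        exact hh ⟨(q, a), by simp, hne⟩
      simp only [stepLaw, Sum.elim_inl, horacle]
    · have hzero (K : SimpleGraph (Fin n)) : stepLaw K k (.inl q) h = 0 := by
        rw [PMF.apply_eq_zero_iff]
        intro hK
        obtain ⟨a, -, ha⟩ := (PMF.mem_support_map_iff _ _ _).mp hK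
        exact hmem ⟨a, ha⟩
      rw [hzero, hzero]
  · rfl

lemma run_apply_eq_of_notMem_distinguishing {t : ℕ} {h : History n}
    (hh : h ∉ distinguishing G G') : run A G t h = run A G' t h := by
  induction t generalizing h with
  | zero => rfl
  | succ t ih =>
    rw [run_succ, run_succ, PMF.bind_apply, PMF.bind_apply]
    refine tsum_congr fun k => ?_
    rw [stepLaw_apply_eq_of_notMem_distinguishing hh]
    by_cases hkh : k <+: h
    · rw [ih fun ⟨p, hp, hne⟩ => hh ⟨p, hkh.subset hp, hne⟩]
    · simp only [stepLaw_apply_eq_zero hkh, mul_zero]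

lemma toOuterMeasure_run_le_add_distinguishing (t : ℕ) (E : Set (History n)) :
    (run A G t).toOuterMeasure E ≤
      (run A G' t).toOuterMeasure E + (run A G t).toOuterMeasure (distinguishing G G') := by
  simp only [PMF.toOuterMeasure_apply]
  rw [← ENNReal.tsum_add]
  refine ENNReal.tsum_le_tsum fun h => ?_
  by_cases hd : h ∈ distinguishing G G'
  · rw [Set.indicator_of_mem hd]
    exact (Set.indicator_le_self _ _ _).trans le_add_self
  · rw [show E.indicator (run A G t) h = E.indicator (run A G' t) h by
      simp only [Set.indicator, run_apply_eq_of_notMem_distinguishing hd]]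
    exact le_self_add

lemma probOutput_add_probOutput_le {S S' : Set ℝ} (hS : Disjoint S S') (q : ℕ) :
    A.probOutput G S + A.probOutput G' S' ≤
      1 + ((run A G q).toOuterMeasure (distinguishing G G') +
        (run A G q).toOuterMeasure (pending A)) :=
  calc A.probOutput G S + A.probOutput G' S'
      ≤ ((run A G q).toOuterMeasure (haltsIn A S) + (run A G q).toOuterMeasure (pending A)) +
          A.probOutput G' S' := by
        gcongr
        exact probOutput_le S q
    _ ≤ (((run A G' q).toOuterMeasure (haltsIn A S) +
          (run A G q).toOuterMeasure (distinguishing G G')) +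
          (run A G q).toOuterMeasure (pending A)) + A.probOutput G' S' := by
        gcongr
        exact toOuterMeasure_run_le_add_distinguishing q _
    _ = ((run A G' q).toOuterMeasure (haltsIn A S) + A.probOutput G' S') +
          ((run A G q).toOuterMeasure (distinguishing G G') +
          (run A G q).toOuterMeasure (pending A)) := by ring
    _ ≤ _ := by
        gcongr
        exact toOuterMeasure_haltsIn_add_probOutput_le_one hS q

lemma toOuterMeasure_pending_le (q : ℕ) :
    (run A G q).toOuterMeasure (pending A) ≤
      (run A G (q + 1)).toOuterMeasure {h | h.length = q + 1} := by
  rw [run_succ, PMF.toOuterMeasure_bind_apply, PMF.toOuterMeasure_apply]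
  refine ENNReal.tsum_le_tsum fun h => ?_
  by_cases hsupport : h ∈ (run A G q).support
  · by_cases hh : h ∈ pending A
    · obtain ⟨p, hp⟩ := id hh
      have hpreimage : (fun a => h ++ [(p, a)]) ⁻¹' {h | h.length = q + 1} = Set.univ :=
        Set.eq_univ_of_forall fun a => by simp [(length_of_mem_support_run hsupport).2 hh]
      rw [Set.indicator_of_mem hh, hp, stepLaw, Sum.elim_inl, PMF.toOuterMeasure_map_apply,
        hpreimage, toOuterMeasure_univ, mul_one]
    · simp [hh]
  · simp [(PMF.apply_eq_zero_iff _ _).mpr hsupport]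

lemma mul_toOuterMeasure_pending_le_expectedQueries (q : ℕ) :
    ((q : ℝ≥0∞) + 1) * (run A G q).toOuterMeasure (pending A) ≤ A.expectedQueries G :=
  calc ((q : ℝ≥0∞) + 1) * (run A G q).toOuterMeasure (pending A)
      ≤ ((q : ℝ≥0∞) + 1) * (run A G (q + 1)).toOuterMeasure {h | h.length = q + 1} :=
        mul_le_mul_right (toOuterMeasure_pending_le q) _
    _ ≤ ∑' h, run A G (q + 1) h * (h.length : ℝ≥0∞) := by
        rw [PMF.toOuterMeasure_apply, ← ENNReal.tsum_mul_left]
        refine ENNReal.tsum_le_tsum fun h => ?_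
        by_cases hl : h.length = q + 1 <;> simp [hl, mul_comm]
    _ ≤ A.expectedQueries G :=
        le_iSup (fun t => ∑' h, run A G t h * (h.length : ℝ≥0∞)) (q + 1)

end Rounds

section RandomizedAlgorithms

variable {n : ℕ} {Ω : Type*} [MeasurableSpace Ω]

instance instCountableQuery : Countable (Query n) := by
  let f : Query n → Fin n ⊕ Fin n ⊕ Finset (Fin n)
    | .deg v => .inl v
    | .neigh v => .inr (.inl v)
    | .indep S => .inr (.inr S)
  have hf : Function.Injective f := fun p q hpq => by cases p <;> cases q <;> simp_all [f]
  exact hf.countable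

instance instCountableAnswer : Countable (Answer n) := by
  let f : Answer n → ℕ ⊕ Option (Fin n) ⊕ Bool
    | .deg d => .inl d
    | .neigh v => .inr (.inl v)
    | .indep b => .inr (.inr b)
  have hf : Function.Injective f := fun p q hpq => by cases p <;> cases q <;> simp_all [f]
  exact hf.countable

lemma measurable_stepLaw_apply (G : SimpleGraph (Fin n)) (k h : History n) :
    Measurable fun s => stepLaw G k s h := by
  refine measurable_fun_sum ?_ measurable_const
  exact measurable_from_top

lemma RandAlg.measurable_run_apply (A : RandAlg n Ω) (G : SimpleGraph (Fin n)) (t : ℕ)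
    (h : History n) : Measurable fun ω => run (A.toDet ω) G t h := by
  induction t generalizing h with
  | zero => exact measurable_const
  | succ t ih =>
    simp only [run_succ, PMF.bind_apply]
    exact Measurable.tsum fun k =>
      (ih k).mul ((measurable_stepLaw_apply G k h).comp (A.measurable_toDet k))

lemma RandAlg.measurable_toOuterMeasure_run (A : RandAlg n Ω) (G : SimpleGraph (Fin n)) (t : ℕ)
    (E : Set (History n)) : Measurable fun ω => (run (A.toDet ω) G t).toOuterMeasure E := by
  simp only [PMF.toOuterMeasure_apply]
  refine Measurable.tsum fun h => ?_
  by_cases hh : h ∈ E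
  · simpa only [Set.indicator_of_mem hh] using A.measurable_run_apply G t h
  · simp only [Set.indicator_of_notMem hh, measurable_const]

variable (μ : MeasureTheory.Measure Ω) (A : RandAlg n Ω)

lemma RandAlg.mul_lintegral_pending_le_expectedQueries (G : SimpleGraph (Fin n)) (q : ℕ) :
    ((q : ℝ≥0∞) + 1) * ∫⁻ ω, (run (A.toDet ω) G q).toOuterMeasure (pending (A.toDet ω)) ∂μ ≤
      A.expectedQueries μ G :=
  (MeasureTheory.lintegral_const_mul_le _ _).trans
    (MeasureTheory.lintegral_mono fun _ => mul_toOuterMeasure_pending_le_expectedQueries q)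

lemma RandAlg.probOutput_add_probOutput_le [MeasureTheory.IsProbabilityMeasure μ]
    (G G' : SimpleGraph (Fin n)) {S S' : Set ℝ} (hS : Disjoint S S') (q : ℕ) :
    A.probOutput μ G S + A.probOutput μ G' S' ≤
      1 + (∫⁻ ω, (run (A.toDet ω) G q).toOuterMeasure (distinguishing G G') ∂μ +
        ∫⁻ ω, (run (A.toDet ω) G q).toOuterMeasure (pending (A.toDet ω)) ∂μ) :=
  calc A.probOutput μ G S + A.probOutput μ G' S'
      ≤ ∫⁻ ω, ((A.toDet ω).probOutput G S + (A.toDet ω).probOutput G' S') ∂μ :=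
        MeasureTheory.le_lintegral_add _ _
    _ ≤ ∫⁻ ω, (1 + ((run (A.toDet ω) G q).toOuterMeasure (distinguishing G G') +
          (run (A.toDet ω) G q).toOuterMeasure (pending (A.toDet ω)))) ∂μ :=
        MeasureTheory.lintegral_mono fun _ => HybridModel.probOutput_add_probOutput_le hS q
    _ = _ := by
        rw [MeasureTheory.lintegral_add_left measurable_const,
          MeasureTheory.lintegral_add_left (A.measurable_toOuterMeasure_run G q _),
          MeasureTheory.lintegral_const, MeasureTheory.measure_univ, one_mul]

variable {A μ}

/-- The outputs that estimate the number of edges of `G` within a factor `1 ± ε`. -/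
def accurateOutputs (ε : ℝ) (G : SimpleGraph (Fin n)) : Set ℝ :=
  Set.Icc ((1 - ε) * (G.edgeSet.ncard : ℝ)) ((1 + ε) * (G.edgeSet.ncard : ℝ))

lemma disjoint_accurateOutputs {ε : ℝ} {G G' : SimpleGraph (Fin n)}
    (h : (1 + ε) * (G.edgeSet.ncard : ℝ) < (1 - ε) * (G'.edgeSet.ncard : ℝ)) :
    Disjoint (accurateOutputs ε G) (accurateOutputs ε G') :=
  Set.disjoint_left.mpr fun _ hx hx' => (hx.2.trans_lt h).not_ge hx'.1

lemma RandAlg.EstimatesEdges.le_expectedQueries [MeasureTheory.IsProbabilityMeasure μ] {ε : ℝ}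
    (hA : A.EstimatesEdges μ ε) {G G' : SimpleGraph (Fin n)}
    (hGG' : Disjoint (accurateOutputs ε G) (accurateOutputs ε G')) {q : ℕ}
    (hq : ∫⁻ ω, (run (A.toDet ω) G q).toOuterMeasure (distinguishing G G') ∂μ ≤ 1 / 12) :
    ((q : ℝ≥0∞) + 1) / 4 ≤ A.expectedQueries μ G := by
  have hpending :
      1 / 4 ≤ ∫⁻ ω, (run (A.toDet ω) G q).toOuterMeasure (pending (A.toDet ω)) ∂μ := by
    have hsplit : (2 / 3 + 2 / 3 : ℝ≥0∞) = (1 + 1 / 12) + 1 / 4 := by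
      rw [← ENNReal.toReal_eq_toReal_iff' (by finiteness) (by finiteness)]
      norm_num [ENNReal.toReal_add, ENNReal.div_eq_top]
    refine (ENNReal.add_le_add_iff_left (a := 1 + 1 / 12) (by finiteness)).mp ?_
    calc (1 + 1 / 12 : ℝ≥0∞) + 1 / 4 ≤ _ := hsplit ▸ add_le_add (hA G) (hA G')
      _ ≤ _ := A.probOutput_add_probOutput_le μ G G' hGG' q
      _ ≤ _ := by
        rw [← add_assoc]
        gcongr
  calc ((q : ℝ≥0∞) + 1) / 4 = ((q : ℝ≥0∞) + 1) * (1 / 4) := by rw [mul_one_div]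
    _ ≤ _ := by gcongr
    _ ≤ _ := A.mul_lintegral_pending_le_expectedQueries μ G q

lemma RandAlg.EstimatesEdges.exists_le_expectedQueries [MeasureTheory.IsProbabilityMeasure μ]
    {ε : ℝ} (hA : A.EstimatesEdges μ ε) {ι : Type*} [Fintype ι] [Nonempty ι]
    {G G' : ι → SimpleGraph (Fin n)}
    (hGG' : ∀ i, Disjoint (accurateOutputs ε (G i)) (accurateOutputs ε (G' i))) {q : ℕ}
    (hq : ∀ B : DetAlg n,
      ∑ i, (run B (G i) q).toOuterMeasure (distinguishing (G i) (G' i)) ≤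
        (Fintype.card ι : ℝ≥0∞) / 12) :
    ∃ i, ((q : ℝ≥0∞) + 1) / 4 ≤ A.expectedQueries μ (G i) := by
  by_contra! hlt
  have hsum : ∑ i, ∫⁻ ω, (run (A.toDet ω) (G i) q).toOuterMeasure
      (distinguishing (G i) (G' i)) ∂μ ≤ ∑ _i : ι, 1 / 12 := by
    rw [← MeasureTheory.lintegral_finsetSum _ fun i _ =>
      A.measurable_toOuterMeasure_run (G i) q _]
    calc _ ≤ ∫⁻ _ω, (Fintype.card ι : ℝ≥0∞) / 12 ∂μ :=
          MeasureTheory.lintegral_mono fun ω => hq (A.toDet ω)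
      _ = ∑ _i : ι, 1 / 12 := by simp [div_eq_mul_inv]
  refine hsum.not_gt (ENNReal.sum_lt_sum_of_nonempty Finset.univ_nonempty fun i _ => ?_)
  by_contra! hi
  exact (hlt i).not_ge (hA.le_expectedQueries (hGG' i) hi)

end RandomizedAlgorithms

section Oracle

variable {n : ℕ} {G G' : SimpleGraph (Fin n)}

lemma oracle_deg (G : SimpleGraph (Fin n)) (v : Fin n) :
    oracle G (.deg v) = PMF.pure (.deg (G.neighborSet v).ncard) := by
  classical
  rw [Set.ncard_eq_toFinset_card']
  simp only [oracle, SimpleGraph.degree, SimpleGraph.neighborFinset]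

lemma oracle_deg_congr {v : Fin n} (h : G.neighborSet v = G'.neighborSet v) :
    oracle G (.deg v) = oracle G' (.deg v) := by
  rw [oracle_deg, oracle_deg, h]

lemma oracle_neigh_congr {v : Fin n} (h : G.neighborSet v = G'.neighborSet v) :
    oracle G (.neigh v) = oracle G' (.neigh v) := by
  classical
  simp only [oracle, randomNeighbor, SimpleGraph.neighborFinset, h]
  congr!

lemma oracle_indep_congr {S : Finset (Fin n)}
    (h : G.IsIndepSet (S : Set (Fin n)) ↔ G'.IsIndepSet (S : Set (Fin n))) :
    oracle G (.indep S) = oracle G' (.indep S) :=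
  congrArg (fun b => PMF.pure (Answer.indep b)) (decide_eq_decide.mpr h)

lemma uniformOfFinset_map_eq_map_uniformOfFintype {α β : Type*} [Fintype α] [Nonempty α]
    (f : α ↪ β) :
    PMF.uniformOfFinset (Finset.univ.map f) (Finset.univ_nonempty.map) =
      (PMF.uniformOfFintype α).map f := by
  classical
  ext b
  rw [PMF.uniformOfFinset_apply, PMF.map_apply]
  by_cases hb : ∃ a, f a = b
  · obtain ⟨a, rfl⟩ := hb
    simp [f.injective.eq_iff]
  · push Not at hb
    simp [hb, fun a => (hb a).symm]

lemma randomNeighbor_of_neighborSet_eq_range {α : Type*} [Fintype α] [Nonempty α] (f : α ↪ Fin n)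
    {v : Fin n} (hf : G.neighborSet v = Set.range f) :
    randomNeighbor G v = (PMF.uniformOfFintype α).map fun a => some (f a) := by
  classical
  have hneighborFinset : G.neighborFinset v = Finset.univ.map f := by
    ext u
    simpa using Set.ext_iff.mp hf u
  have hmap : (PMF.uniformOfFintype α).map (fun a => some (f a)) =
      (PMF.uniformOfFinset (Finset.univ.map f) (Finset.univ_nonempty.map)).map some := by
    rw [uniformOfFinset_map_eq_map_uniformOfFintype, PMF.map_comp]
    rfl
  rw [hmap, randomNeighbor, dif_pos]
  · congr!
  · convert Finset.univ_nonempty.map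
    infer_instance

lemma randomNeighbor_of_neighborSet_eq_singleton {u v : Fin n} (h : G.neighborSet v = {u}) :
    randomNeighbor G v = PMF.pure (some u) := by
  rw [randomNeighbor_of_neighborSet_eq_range (α := Unit) ⟨fun _ => u, fun _ _ _ => rfl⟩
    (h.trans Set.range_const.symm)]
  exact map_eq_pure_of_forall_eq _ fun _ => rfl

lemma randomNeighbor_of_neighborSet_eq_empty {v : Fin n} (h : G.neighborSet v = ∅) :
    randomNeighbor G v = PMF.pure none := by
  rw [randomNeighbor, dif_neg]
  rintro ⟨u, hu⟩
  rw [SimpleGraph.mem_neighborFinset, ← SimpleGraph.mem_neighborSet, h] at hu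
  exact hu

end Oracle

section EdgeCounts

variable {V : Type*}

lemma ncard_edgeSet_map_top {α : Type*} [Fintype α] (f : α ↪ V) :
    ((⊤ : SimpleGraph α).map f).edgeSet.ncard = (Fintype.card α).choose 2 := by
  classical
  rw [SimpleGraph.edgeSet_map, Set.ncard_image_of_injective _ f.sym2Map.injective,
    ← SimpleGraph.coe_edgeFinset, Set.ncard_coe_finset,
    SimpleGraph.card_edgeFinset_top_eq_card_choose_two]

lemma ncard_edgeSet_between_top {S T : Set V} (hST : Disjoint S T) :
    ((⊤ : SimpleGraph V).between S T).edgeSet.ncard = S.ncard * T.ncard := by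
  have himage : ((⊤ : SimpleGraph V).between S T).edgeSet = Sym2.mk.uncurry '' (S ×ˢ T) := by
    ext e
    induction e with
    | _ u v =>
      simp only [SimpleGraph.mem_edgeSet, SimpleGraph.between_adj, SimpleGraph.top_adj,
        Set.mem_image, Set.mem_prod, Prod.exists, Function.uncurry_apply_pair, Sym2.eq_iff]
      constructor
      · rintro ⟨-, ⟨hu, hv⟩ | ⟨hu, hv⟩⟩
        · exact ⟨u, v, ⟨hu, hv⟩, .inl ⟨rfl, rfl⟩⟩
        · exact ⟨v, u, ⟨hv, hu⟩, .inr ⟨rfl, rfl⟩⟩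
      · rintro ⟨s, t, ⟨hs, ht⟩, ⟨rfl, rfl⟩ | ⟨rfl, rfl⟩⟩
        · exact ⟨hST.ne_of_mem hs ht, .inl ⟨hs, ht⟩⟩
        · exact ⟨(hST.ne_of_mem hs ht).symm, .inr ⟨ht, hs⟩⟩
  rw [himage, Set.InjOn.ncard_image, Set.ncard_prod]
  rintro ⟨s, t⟩ ⟨hs, -⟩ ⟨s', t'⟩ ⟨-, ht'⟩ h
  rcases Sym2.eq_iff.mp h with ⟨rfl, rfl⟩ | ⟨hst, -⟩
  · rfl
  · exact (hST.ne_of_mem hs ht' hst).elim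

lemma ncard_edgeSet_sup [Finite V] {G H : SimpleGraph V} (hGH : Disjoint G H) :
    (G ⊔ H).edgeSet.ncard = G.edgeSet.ncard + H.edgeSet.ncard := by
  rw [SimpleGraph.edgeSet_sup, Set.ncard_union_eq (SimpleGraph.disjoint_edgeSet.mpr hGH)]

lemma exists_ge_ncard_edgeSet_eq [Fintype V] (H : SimpleGraph V) {m : ℕ} (hH : H.edgeSet.ncard ≤ m)
    (hm : m ≤ (Fintype.card V).choose 2) :
    ∃ G : SimpleGraph V, H ≤ G ∧ G.edgeSet.ncard = m := by
  classical
  rw [← SimpleGraph.coe_edgeFinset, Set.ncard_coe_finset] at hH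
  rw [← SimpleGraph.card_edgeFinset_top_eq_card_choose_two] at hm
  obtain ⟨E, hHE, hE, hcard⟩ :=
    Finset.exists_subsuperset_card_eq (SimpleGraph.edgeFinset_mono le_top) hH hm
  have hedgeSet : (SimpleGraph.fromEdgeSet (E : Set (Sym2 V))).edgeSet = E := by
    rw [SimpleGraph.edgeSet_fromEdgeSet, sdiff_eq_left, Set.disjoint_left]
    exact fun e he => SimpleGraph.not_isDiag_of_mem_edgeFinset (hE he)
  refine ⟨SimpleGraph.fromEdgeSet E, ?_, ?_⟩
  · rw [← SimpleGraph.edgeSet_subset_edgeSet, hedgeSet, ← SimpleGraph.coe_edgeFinset]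
    exact Finset.coe_subset.mpr hHE
  · rw [hedgeSet, Set.ncard_coe_finset, hcard]

end EdgeCounts

section Cells

variable {α β γ : Type*}

/-- The `a`-th cell of a family of disjoint copies of `β` in `γ` indexed by `α`. -/
def cell (e : α × β ↪ γ) (a : α) : β ↪ γ := (Function.Embedding.sectR a β).trans e

lemma ncard_cells_meeting_le [Finite α] (e : α × β ↪ γ) (S : Finset γ) :
    {a | ∃ v ∈ S, v ∈ Set.range (cell e a)}.ncard ≤ S.card := by
  have hmeeting : {a | ∃ v ∈ S, v ∈ Set.range (cell e a)} = Prod.fst '' (e ⁻¹' (S : Set γ)) := by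
    ext a
    constructor
    · rintro ⟨_, hv, b, rfl⟩
      exact ⟨(a, b), hv, rfl⟩
    · rintro ⟨⟨a, b⟩, hv, rfl⟩
      exact ⟨_, hv, b, rfl⟩
  have hfinite : (e ⁻¹' (S : Set γ)).Finite := S.finite_toSet.preimage e.injective.injOn
  calc _ = (Prod.fst '' (e ⁻¹' (S : Set γ))).ncard := by rw [hmeeting]
    _ ≤ (e ⁻¹' (S : Set γ)).ncard := Set.ncard_image_le hfinite
    _ = (e '' (e ⁻¹' (S : Set γ))).ncard := (Set.ncard_image_of_injective _ e.injective).symm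
    _ ≤ (S : Set γ).ncard := Set.ncard_le_ncard (Set.image_preimage_subset _ _)
    _ = S.card := Set.ncard_coe_finset S

end Cells

section Removal

variable {n : ℕ} {α : Type*}

/-- `G` without the edges inside the range of `f`. -/
def removeClique (G : SimpleGraph (Fin n)) (f : α ↪ Fin n) : SimpleGraph (Fin n) :=
  G \ (⊤ : SimpleGraph α).map f

lemma neighborSet_removeClique_of_notMem (G : SimpleGraph (Fin n)) {f : α ↪ Fin n} {v : Fin n}
    (hv : v ∉ Set.range f) : G.neighborSet v = (removeClique G f).neighborSet v := by
  ext u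
  simp only [removeClique, SimpleGraph.mem_neighborSet, SimpleGraph.sdiff_adj,
    SimpleGraph.map_adj, iff_self_and]
  rintro - ⟨i, -, -, rfl, -⟩
  exact hv ⟨i, rfl⟩

/-- For an independent set query on a set with an edge, an endpoint of that edge will do. -/
lemma exists_card_le_one_of_oracle_removeClique_ne (G : SimpleGraph (Fin n)) (r : Query n) :
    ∃ S : Finset (Fin n), S.card ≤ 1 ∧ ∀ f : α ↪ Fin n,
      oracle G r ≠ oracle (removeClique G f) r → ∃ v ∈ S, v ∈ Set.range f := by
  cases r with
  | deg v =>
    refine ⟨{v}, by simp, fun f hne => ⟨v, by simp, ?_⟩⟩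
    by_contra hv
    exact hne (oracle_deg_congr (neighborSet_removeClique_of_notMem G hv))
  | neigh v =>
    refine ⟨{v}, by simp, fun f hne => ⟨v, by simp, ?_⟩⟩
    by_contra hv
    exact hne (oracle_neigh_congr (neighborSet_removeClique_of_notMem G hv))
  | indep S =>
    by_cases hS : G.IsIndepSet (S : Set (Fin n))
    · refine ⟨∅, by simp, fun f hne => (hne (oracle_indep_congr (iff_of_true hS ?_))).elim⟩
      exact fun u hu v hv huv hadj => hS hu hv huv hadj.1
    · obtain ⟨u, hu, v, hv, huv⟩ : ∃ u ∈ S, ∃ v ∈ S, G.Adj u v := by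
        by_contra! hadj
        exact hS fun u hu v hv _ => hadj u hu v hv
      refine ⟨{u}, by simp, fun f hne => ⟨u, by simp, ?_⟩⟩
      by_contra hf
      refine hne (oracle_indep_congr (iff_of_false hS fun h => h hu hv huv.ne ?_))
      exact (neighborSet_removeClique_of_notMem G hf).subset huv

lemma exists_card_le_length_of_mem_distinguishing_removeClique (G : SimpleGraph (Fin n))
    (h : History n) :
    ∃ S : Finset (Fin n), S.card ≤ h.length ∧ ∀ f : α ↪ Fin n,
      h ∈ distinguishing G (removeClique G f) → ∃ v ∈ S, v ∈ Set.range f := by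
  classical
  choose S hcard hS using exists_card_le_one_of_oracle_removeClique_ne (α := α) G
  refine ⟨h.toFinset.biUnion fun p => S p.1, ?_, ?_⟩
  · calc _ ≤ h.toFinset.card * 1 := Finset.card_biUnion_le_card_mul _ _ _ fun p _ => hcard p.1
      _ ≤ h.length := (mul_one _).trans_le h.toFinset_card_le
  · rintro f ⟨p, hp, hne⟩
    obtain ⟨v, hv, hvf⟩ := hS p.1 f hne
    exact ⟨v, Finset.mem_biUnion.mpr ⟨p, List.mem_toFinset.mpr hp, hv⟩, hvf⟩

lemma sum_distinguishing_removeClique_le {ι : Type*} [Fintype ι] (B : DetAlg n)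
    (G : SimpleGraph (Fin n)) (e : ι × α ↪ Fin n) (q : ℕ) :
    ∑ i, (run B G q).toOuterMeasure (distinguishing G (removeClique G (cell e i))) ≤ q := by
  refine sum_toOuterMeasure_le _ _ fun h hh => Nat.cast_le.mpr ?_
  obtain ⟨S, hcard, hS⟩ := exists_card_le_length_of_mem_distinguishing_removeClique (α := α) G h
  calc {i | h ∈ distinguishing G (removeClique G (cell e i))}.ncard
      ≤ {i | ∃ v ∈ S, v ∈ Set.range (cell e i)}.ncard :=
        Set.ncard_le_ncard fun i hi => hS (cell e i) hi
    _ ≤ S.card := ncard_cells_meeting_le e S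
    _ ≤ h.length := hcard
    _ ≤ q := (length_of_mem_support_run hh).1

lemma ncard_edgeSet_removeClique_add [Fintype α] {G : SimpleGraph (Fin n)} {f : α ↪ Fin n}
    (hG : (⊤ : SimpleGraph α).map f ≤ G) :
    (removeClique G f).edgeSet.ncard + (Fintype.card α).choose 2 = G.edgeSet.ncard := by
  rw [removeClique, SimpleGraph.edgeSet_sdiff, ← ncard_edgeSet_map_top f]
  exact Set.ncard_sdiff_add_ncard_of_subset (SimpleGraph.edgeSet_subset_edgeSet.mpr hG)

lemma exists_clique_cells_le_ncard_edgeSet_eq {p z s m : ℕ} (hpz : p * z ≤ s) (hsn : s ≤ n)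
    (hs : s.choose 2 ≤ m) (hm : m ≤ n.choose 2) :
    ∃ (G : SimpleGraph (Fin n)) (e : Fin p × Fin z ↪ Fin n), G.edgeSet.ncard = m ∧
      ∀ a, (⊤ : SimpleGraph (Fin z)).map (cell e a) ≤ G := by
  obtain ⟨f⟩ : Nonempty (Fin p × Fin z ↪ Fin s) :=
    Function.Embedding.nonempty_of_card_le (by simpa using hpz)
  let g : Fin s ↪ Fin n := Fin.castLEEmb hsn
  obtain ⟨G, hG, hGm⟩ := exists_ge_ncard_edgeSet_eq ((⊤ : SimpleGraph (Fin s)).map g) (m := m)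
    (by simpa [ncard_edgeSet_map_top] using hs) (by simpa using hm)
  refine ⟨G, f.trans g, hGm, fun a => ?_⟩
  calc (⊤ : SimpleGraph (Fin z)).map (cell (f.trans g) a)
      = ((⊤ : SimpleGraph (Fin z)).map (cell f a)).map g := by
        rw [SimpleGraph.map_map]; rfl
    _ ≤ (⊤ : SimpleGraph (Fin s)).map g := SimpleGraph.map_monotone g le_top
    _ ≤ G := hG

lemma RandAlg.EstimatesEdges.exists_le_expectedQueries_of_removal {Ω : Type*} [MeasurableSpace Ω]
    {μ : MeasureTheory.Measure Ω} [MeasureTheory.IsProbabilityMeasure μ] {A : RandAlg n Ω}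
    {ε : ℝ} (hA : A.EstimatesEdges μ ε) {m s q z : ℕ} (hq : 0 < q) (hqz : 12 * q * z ≤ s)
    (hsn : s ≤ n) (hs : s.choose 2 ≤ m) (hm : m ≤ n.choose 2)
    (hgap : ∀ m' : ℕ, m' + z.choose 2 = m → (1 + ε) * m' < (1 - ε) * m) :
    ∃ G : SimpleGraph (Fin n), G.edgeSet.ncard = m ∧
      ((q : ℝ≥0∞) + 1) / 4 ≤ A.expectedQueries μ G := by
  obtain ⟨G, e, hGm, he⟩ := exists_clique_cells_le_ncard_edgeSet_eq hqz hsn hs hm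
  have hdisjoint (a : Fin (12 * q)) :
      Disjoint (accurateOutputs ε G) (accurateOutputs ε (removeClique G (cell e a))) := by
    refine (disjoint_accurateOutputs ?_).symm
    rw [hGm]
    refine hgap _ ?_
    rw [← hGm, ← ncard_edgeSet_removeClique_add (he a), Fintype.card_fin]
  have hcard : (q : ℝ≥0∞) = (Fintype.card (Fin (12 * q)) : ℝ≥0∞) / 12 := by
    rw [ENNReal.eq_div_iff (by simp) (by simp)]
    simp
  have : Nonempty (Fin (12 * q)) := ⟨⟨0, by positivity⟩⟩
  obtain ⟨-, hi⟩ := hA.exists_le_expectedQueries hdisjoint fun B =>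
    (sum_distinguishing_removeClique_le B G e q).trans_eq hcard
  exact ⟨G, hGm, hi⟩

end Removal

section Chernoff

lemma sum_ite_half_le {β : Type*} (s : Finset β) (p : β → Prop) [DecidablePred p] :
    ∑ y ∈ s, (if p y then (1 / 2 : ℝ) else 1) ≤
      s.card * Real.exp (-((s.filter p).card / (2 * s.card))) := by
  rcases s.eq_empty_or_nonempty with rfl | hs
  · simp
  have : (0 : ℝ) < s.card := by exact_mod_cast hs.card_pos
  have hcard : ((s.filter p).card : ℝ) + (s.filter fun y => ¬ p y).card = s.card := by
    exact_mod_cast s.card_filter_add_card_filter_not p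
  calc ∑ y ∈ s, (if p y then (1 / 2 : ℝ) else 1)
      = s.card * (-((s.filter p).card / (2 * s.card)) + 1) := by
        rw [Finset.sum_ite, Finset.sum_const, Finset.sum_const, nsmul_eq_mul, nsmul_one]
        field_simp
        linarith
    _ ≤ _ := by
        gcongr
        exact Real.add_one_le_exp _

lemma thirty_six_mul_four_mul_exp_neg_five_pow_le_one {q : ℕ} (hq : 0 < q) :
    36 * (4 * Real.exp (-5)) ^ q ≤ 1 := by
  have hexp : (2.718 : ℝ) ^ 5 ≤ Real.exp 5 := by
    rw [show (5 : ℝ) = (5 : ℕ) by norm_num, ← Real.exp_one_pow]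
    gcongr
    linarith [Real.exp_one_gt_d9]
  have hle : 4 * Real.exp (-5) ≤ 1 / 36 := by
    rw [Real.exp_neg, ← div_eq_mul_inv, div_le_div_iff₀ (Real.exp_pos _) (by norm_num)]
    linarith
  calc 36 * (4 * Real.exp (-5)) ^ q ≤ 36 * (1 / 36) ^ q := by gcongr
    _ ≤ 36 * (1 / 36) ^ 1 := by
        gcongr 36 * ?_
        exact pow_le_pow_of_le_one (by norm_num) (by norm_num) hq
    _ = 1 := by norm_num

variable {ι β : Type*} [Fintype ι] [DecidableEq ι] [DecidableEq β]

/-- The coordinates at which the graph of `x` meets `W`. -/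
def hits (W : Finset (ι × β)) (x : ι → β) : Finset ι := {j | (j, x j) ∈ W}

/-- Chernoff's method: Markov's inequality for `2 ^ (-#hits)`. -/
lemma card_filter_card_hits_le (t : ι → Finset β) (W : Finset (ι × β)) (q : ℕ) :
    (((Fintype.piFinset t).filter fun x => (hits W x).card ≤ q).card : ℝ) ≤
      2 ^ q * ((Fintype.piFinset t).card *
        Real.exp (-∑ j, (((t j).filter fun y => (j, y) ∈ W).card : ℝ) / (2 * (t j).card))) := by
  let f (j : ι) (y : β) : ℝ := if (j, y) ∈ W then 1 / 2 else 1
  have hf (j : ι) (y : β) : 0 ≤ f j y := by positivity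
  have hprod (x : ι → β) : ∏ j, f j (x j) = (1 / 2) ^ (hits W x).card := by
    simp only [f, Finset.prod_ite, Finset.prod_const, one_pow, mul_one, hits]
  calc (((Fintype.piFinset t).filter fun x => (hits W x).card ≤ q).card : ℝ)
      = ∑ x ∈ (Fintype.piFinset t).filter (fun x => (hits W x).card ≤ q), 1 := by simp
    _ ≤ ∑ x ∈ Fintype.piFinset t, 2 ^ q * ∏ j, f j (x j) := by
        refine (Finset.sum_le_sum fun x hx => ?_).trans (Finset.sum_le_sum_of_subset_of_nonneg
          (Finset.filter_subset _ _) fun x _ _ =>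
            mul_nonneg (by positivity) (Finset.prod_nonneg fun j _ => hf j _))
        calc (1 : ℝ) = 2 ^ q * (1 / 2) ^ q := by rw [← mul_pow]; norm_num
          _ ≤ 2 ^ q * (1 / 2) ^ (hits W x).card := by
            gcongr 2 ^ q * ?_
            exact pow_le_pow_of_le_one (by norm_num) (by norm_num) (Finset.mem_filter.mp hx).2
          _ = _ := by rw [hprod]
    _ = 2 ^ q * ∏ j, ∑ y ∈ t j, f j y := by rw [← Finset.mul_sum, ← Finset.prod_univ_sum]
    _ ≤ 2 ^ q * ∏ j, ((t j).card *
          Real.exp (-(((t j).filter fun y => (j, y) ∈ W).card / (2 * (t j).card)))) := by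
        gcongr with j
        exact sum_ite_half_le (t j) _
    _ = _ := by
        rw [Finset.prod_mul_distrib, ← Real.exp_sum, Finset.sum_neg_distrib,
          Fintype.card_piFinset, Nat.cast_prod]

end Chernoff

section Boxes

variable {ι β : Type*} [Fintype ι] [DecidableEq ι] [Fintype β]

/-- The functions that agree with `x₀` on `J`. -/
def box (J : Finset ι) (x₀ : ι → β) : Finset (ι → β) :=
  Fintype.piFinset fun j => if j ∈ J then {x₀ j} else Finset.univ

lemma mem_box {J : Finset ι} {x₀ x : ι → β} : x ∈ box J x₀ ↔ ∀ j ∈ J, x j = x₀ j := by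
  rw [box, Fintype.mem_piFinset]
  refine forall_congr' fun j => ?_
  split_ifs with h <;> simp [h]

lemma mul_card_filter_le_card_of_box {J : Finset ι} {P : (ι → β) → Prop} [DecidablePred P] {c : ℕ}
    (h : ∀ x₀, c * ((box J x₀).filter P).card ≤ (box J x₀).card) :
    c * (Finset.univ.filter P).card ≤ Fintype.card (ι → β) := by
  classical
  have hfiber (x₀ : ι → β) : Finset.univ.filter (fun x => J.restrict x = J.restrict x₀) =
      box J x₀ := by
    ext x
    simp [mem_box, funext_iff]
  calc c * (Finset.univ.filter P).card
      = ∑ y : J → β, c * ((Finset.univ.filter fun x => J.restrict x = y).filter P).card := by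
        rw [Finset.card_eq_sum_card_fiberwise (f := J.restrict) (t := Finset.univ)
          fun _ _ => Finset.mem_univ _, Finset.mul_sum]
        simp only [Finset.filter_comm]
    _ ≤ ∑ y : J → β, (Finset.univ.filter fun x : ι → β => J.restrict x = y).card := by
        gcongr with y
        by_cases hy : ∃ x₀ : ι → β, J.restrict x₀ = y
        · obtain ⟨x₀, rfl⟩ := hy
          simpa only [hfiber] using h x₀
        · rw [Finset.filter_false_of_mem fun x _ hx => hy ⟨x, hx⟩]
          simp
    _ = Fintype.card (ι → β) :=
        (Finset.card_eq_sum_card_fiberwise fun _ _ => Finset.mem_univ _).symm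

variable [DecidableEq β]

lemma card_le_card_mul_add_sum_compl (W : Finset (ι × β)) (J : Finset ι) :
    W.card ≤ J.card * Fintype.card β +
      ∑ j ∈ Jᶜ, (Finset.univ.filter fun y => (j, y) ∈ W).card := by
  have hfiber (j : ι) :
      (W.filter fun p => p.1 = j).card = (Finset.univ.filter fun y => (j, y) ∈ W).card := by
    rw [← Finset.card_map (Function.Embedding.sectR j β)]
    congr 1
    ext ⟨i, y⟩
    simp only [Finset.mem_filter, Finset.mem_map, Finset.mem_univ, true_and,
      Function.Embedding.sectR_apply, Prod.mk.injEq]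
    grind
  calc W.card = ∑ j, (Finset.univ.filter fun y => (j, y) ∈ W).card := by
        simp only [← hfiber]
        exact Finset.card_eq_sum_card_fiberwise fun _ _ => Finset.mem_univ _
    _ = ∑ j ∈ J, (Finset.univ.filter fun y => (j, y) ∈ W).card +
          ∑ j ∈ Jᶜ, (Finset.univ.filter fun y => (j, y) ∈ W).card :=
        (Finset.sum_add_sum_compl J _).symm
    _ ≤ _ := by
        gcongr
        exact Finset.sum_le_card_nsmul J _ _ fun j _ => Finset.card_le_univ _

variable [Nonempty β]

lemma card_filter_box_card_hits_le (J : Finset ι) (x₀ : ι → β) (W : Finset (ι × β)) (q : ℕ) :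
    (((box J x₀).filter fun x => (hits W x).card ≤ q).card : ℝ) ≤
      2 ^ q * ((box J x₀).card *
        Real.exp (-((W.card : ℝ) / (2 * Fintype.card β) - J.card / 2))) := by
  refine (card_filter_card_hits_le _ W q).trans ?_
  rw [← box]
  gcongr
  have hW : (W.card : ℝ) ≤ J.card * Fintype.card β +
      ∑ j ∈ Jᶜ, ((Finset.univ.filter fun y => (j, y) ∈ W).card : ℝ) := by
    exact_mod_cast card_le_card_mul_add_sum_compl W J
  calc (W.card : ℝ) / (2 * Fintype.card β) - J.card / 2
      ≤ (∑ j ∈ Jᶜ, ((Finset.univ.filter fun y => (j, y) ∈ W).card : ℝ)) /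
          (2 * Fintype.card β) := by
        rw [sub_le_iff_le_add, div_le_iff₀ (by positivity)]
        refine hW.trans_eq ?_
        field_simp
        ring
    _ = ∑ j ∈ Jᶜ, ((Finset.univ.filter fun y => (j, y) ∈ W).card : ℝ) /
          (2 * Fintype.card β) := Finset.sum_div _ _ _
    _ ≤ _ := by
        refine le_of_eq_of_le (Finset.sum_congr rfl fun j hj => ?_)
          (Finset.sum_le_sum_of_subset_of_nonneg (Finset.subset_univ Jᶜ)
            fun _ _ _ => by positivity)
        rw [if_neg (Finset.mem_compl.mp hj), Finset.card_univ]

lemma mul_card_filter_box_card_hits_le {q : ℕ} (hq : 0 < q) {J : Finset ι} (hJ : J.card ≤ 2 * q)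
    (x₀ : ι → β) {W : Finset (ι × β)} (hW : 12 * q * Fintype.card β ≤ W.card) :
    36 * (2 ^ q * ((box J x₀).filter fun x => (hits W x).card ≤ q).card) ≤ (box J x₀).card := by
  have hexponent : 5 * (q : ℝ) ≤ (W.card : ℝ) / (2 * Fintype.card β) - J.card / 2 := by
    have hJ' : (J.card : ℝ) ≤ 2 * q := by exact_mod_cast hJ
    have hW' : (12 * q * Fintype.card β : ℝ) ≤ W.card := by exact_mod_cast hW
    have hdiv : 6 * (q : ℝ) ≤ (W.card : ℝ) / (2 * Fintype.card β) := by
      rw [le_div_iff₀ (by positivity)]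
      linarith
    linarith
  have hle : (36 * (2 ^ q * ((box J x₀).filter fun x => (hits W x).card ≤ q).card) : ℝ) ≤
      (box J x₀).card :=
    calc _ ≤ 36 * (2 ^ q * (2 ^ q * ((box J x₀).card * Real.exp (-5) ^ q))) := by
          gcongr
          refine (card_filter_box_card_hits_le J x₀ W q).trans ?_
          rw [← Real.exp_nat_mul]
          gcongr
          linarith
      _ = 36 * (4 * Real.exp (-5)) ^ q * (box J x₀).card := by
          rw [mul_pow, show (4 : ℝ) = 2 * 2 by norm_num, mul_pow]
          ring
      _ ≤ 1 * (box J x₀).card := by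
          gcongr
          exact thirty_six_mul_four_mul_exp_neg_five_pow_le_one hq
      _ = (box J x₀).card := one_mul _
  exact_mod_cast hle

lemma mul_card_filter_large_le_card {α : Type*} {q : ℕ} (hq : 0 < q)
    {J : Finset ι} (hJ : J.card ≤ 2 * q) (H : (ι → β) → α)
    (hH : ∀ x₀ : ι → β, (H '' (box J x₀ : Set (ι → β))).ncard ≤ 2 ^ q) (V : α → Finset (ι × β))
    (hV : ∀ x, (hits (V (H x)) x).card ≤ q) :
    36 * (Finset.univ.filter fun x => 12 * q * Fintype.card β ≤ (V (H x)).card).card ≤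
      Fintype.card (ι → β) := by
  refine mul_card_filter_le_card_of_box (J := J) fun x₀ => ?_
  classical
  let large : Finset α := ((box J x₀).image H).filter fun a => 12 * q * Fintype.card β ≤ (V a).card
  have hsubset : ((box J x₀).filter fun x => 12 * q * Fintype.card β ≤ (V (H x)).card) ⊆
      large.biUnion fun a => (box J x₀).filter fun x => (hits (V a) x).card ≤ q := by
    intro x hx
    rw [Finset.mem_filter] at hx
    exact Finset.mem_biUnion.mpr ⟨H x,
      Finset.mem_filter.mpr ⟨Finset.mem_image_of_mem H hx.1, hx.2⟩,
      Finset.mem_filter.mpr ⟨hx.1, hV x⟩⟩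
  refine le_of_mul_le_mul_left ?_ (pow_pos two_pos q)
  calc 2 ^ q * (36 * ((box J x₀).filter fun x => 12 * q * Fintype.card β ≤ (V (H x)).card).card)
      ≤ 2 ^ q * (36 * ∑ a ∈ large, ((box J x₀).filter fun x => (hits (V a) x).card ≤ q).card) := by
        gcongr
        exact (Finset.card_le_card hsubset).trans Finset.card_biUnion_le
    _ = ∑ a ∈ large,
          36 * (2 ^ q * ((box J x₀).filter fun x => (hits (V a) x).card ≤ q).card) := by
        simp only [← Finset.mul_sum]
        ring
    _ ≤ large.card * (box J x₀).card := Finset.sum_le_card_nsmul _ _ _ fun a ha =>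
        mul_card_filter_box_card_hits_le hq hJ x₀ (Finset.mem_filter.mp ha).2
    _ ≤ 2 ^ q * (box J x₀).card := by
        gcongr
        refine (Finset.card_filter_le _ _).trans ?_
        simpa only [← Set.ncard_coe_finset, Finset.coe_image] using hH x₀

end Boxes

section SeededRuns

variable {n : ℕ} {σ : Type*} {A : DetAlg n} {G : SimpleGraph (Fin n)}

/-- The history after one further round of `A` in which a query `q` is answered by `f q`. -/
def extend (A : DetAlg n) (f : Query n → Answer n) (h : History n) : History n :=
  (A h).elim (fun q => h ++ [(q, f q)]) fun _ => h

/-- The history of `A` when a query `q` made with the seed `r` is answered by `ans r q`. The list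
of seeds starts with the seed of the last round. -/
def seededRun (A : DetAlg n) (ans : σ → Query n → Answer n) (l : List σ) : History n :=
  l.foldr (fun r => extend A (ans r)) []

/-- The law of `t` independent seeds with law `p`. -/
noncomputable def seedLaw (p : PMF σ) : ℕ → PMF (List σ)
  | 0 => PMF.pure []
  | t + 1 => (seedLaw p t).bind fun l => p.map fun r => r :: l

lemma length_of_mem_support_seedLaw {p : PMF σ} {t : ℕ} {l : List σ}
    (hl : l ∈ (seedLaw p t).support) : l.length = t := by
  induction t generalizing l with
  | zero => simp_all [seedLaw]
  | succ t ih =>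
    rw [seedLaw, PMF.mem_support_bind_iff] at hl
    obtain ⟨k, hk, hkl⟩ := hl
    obtain ⟨r, -, rfl⟩ := (PMF.mem_support_map_iff _ _ _).mp hkl
    rw [List.length_cons, ih hk]

lemma stepLaw_eq_map_extend {p : PMF σ} {ans : σ → Query n → Answer n}
    (hans : ∀ q, oracle G q = p.map fun r => ans r q) (h : History n) :
    stepLaw G h (A h) = p.map fun r => extend A (ans r) h := by
  rcases hA : A h with q | x
  · rw [stepLaw, Sum.elim_inl, hans, PMF.map_comp]
    simp only [extend, hA, Sum.elim_inl, Function.comp_def]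
  · exact (map_eq_pure_of_forall_eq p fun r => by rw [extend, hA, Sum.elim_inr]).symm

lemma run_eq_map_seededRun {p : PMF σ} {ans : σ → Query n → Answer n}
    (hans : ∀ q, oracle G q = p.map fun r => ans r q) (t : ℕ) :
    run A G t = (seedLaw p t).map (seededRun A ans) := by
  induction t with
  | zero => exact (PMF.pure_map (seededRun A ans) []).symm
  | succ t ih =>
    rw [run_succ, ih, PMF.bind_map, seedLaw, PMF.map_bind]
    congr 1
    funext l
    rw [Function.comp_apply, stepLaw_eq_map_extend hans, PMF.map_comp]
    rfl

lemma ncard_image_seededRun_le {ι : Type*} (ans : ι → σ → Query n → Answer n) {s : Set ι}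
    (hs : s.Finite) {l : List σ}
    (hans : ∀ r ∈ l, ∀ q, ∃ a₀ a₁, ∀ x ∈ s, ans x r q = a₀ ∨ ans x r q = a₁) :
    ((fun x => seededRun A (ans x) l) '' s).ncard ≤ 2 ^ l.length := by
  induction l with
  | nil =>
    calc ((fun x => seededRun A (ans x) []) '' s).ncard ≤ ({[]} : Set (History n)).ncard :=
          Set.ncard_le_ncard (Set.image_subset_iff.mpr fun _ _ => rfl)
      _ = 2 ^ [].length := Set.ncard_singleton []
  | cons r l ih =>
    choose f₀ f₁ hf using hans r List.mem_cons_self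
    let S : Set (History n) := (fun x => seededRun A (ans x) l) '' s
    have hS : S.Finite := hs.image _
    have hsubset : (fun x => seededRun A (ans x) (r :: l)) '' s ⊆
        extend A f₀ '' S ∪ extend A f₁ '' S := by
      rintro _ ⟨x, hx, rfl⟩
      have hextend : extend A (ans x r) (seededRun A (ans x) l) =
            extend A f₀ (seededRun A (ans x) l) ∨
          extend A (ans x r) (seededRun A (ans x) l) =
            extend A f₁ (seededRun A (ans x) l) := by
        rcases hA : A (seededRun A (ans x) l) with q | y
        · rcases hf q x hx with hq | hq <;> simp [extend, hA, hq]
        · simp [extend, hA]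
      exact hextend.imp (fun h => ⟨_, ⟨x, hx, rfl⟩, h.symm⟩) fun h => ⟨_, ⟨x, hx, rfl⟩, h.symm⟩
    calc _ ≤ (extend A f₀ '' S ∪ extend A f₁ '' S).ncard :=
          Set.ncard_le_ncard hsubset ((hS.image _).union (hS.image _))
      _ ≤ (extend A f₀ '' S).ncard + (extend A f₁ '' S).ncard := Set.ncard_union_le _ _
      _ ≤ S.ncard + S.ncard := add_le_add (Set.ncard_image_le hS) (Set.ncard_image_le hS)
      _ = 2 * S.ncard := (two_mul _).symm
      _ ≤ 2 * 2 ^ l.length := by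
          gcongr
          exact ih fun r hr => hans r (List.mem_cons_of_mem _ hr)
      _ = 2 ^ (r :: l).length := (pow_succ' _ _).symm

end SeededRuns

section HiddenClique

variable {n k : ℕ} {β : Type*}

/-- A clique vertex in every block: the vertex `x i` of the block `i`. -/
def cliqueEmb (blk : Fin (k + 1) × β ↪ Fin n) (x : Fin (k + 1) → β) : Fin (k + 1) ↪ Fin n :=
  ⟨fun i => blk (i, x i), fun _ _ h => congrArg Prod.fst (blk.injective h)⟩

/-- The clique on the vertices `cliqueEmb blk x`, together with the graph `M`. -/
def hiddenClique (blk : Fin (k + 1) × β ↪ Fin n) (M : SimpleGraph (Fin n))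
    (x : Fin (k + 1) → β) : SimpleGraph (Fin n) :=
  (⊤ : SimpleGraph (Fin (k + 1))).map (cliqueEmb blk x) ⊔ M

/-- `M` is a matching that avoids all blocks. -/
structure IsSideMatching (blk : Fin (k + 1) × β ↪ Fin n) (M : SimpleGraph (Fin n)) : Prop where
  subsingleton_neighborSet : ∀ v, (M.neighborSet v).Subsingleton
  not_adj : ∀ p v, ¬ M.Adj (blk p) v

variable {blk : Fin (k + 1) × β ↪ Fin n} {M : SimpleGraph (Fin n)} {x : Fin (k + 1) → β}

lemma blk_mem_range_cliqueEmb_iff {p : Fin (k + 1) × β} :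
    blk p ∈ Set.range (cliqueEmb blk x) ↔ p.2 = x p.1 := by
  constructor
  · rintro ⟨i, hi⟩
    rw [← blk.injective hi]
  · intro hp
    exact ⟨p.1, congrArg blk (Prod.ext rfl hp.symm)⟩

lemma hiddenClique_adj_cliqueEmb_cliqueEmb {i j : Fin (k + 1)} (hij : i ≠ j) :
    (hiddenClique blk M x).Adj (cliqueEmb blk x i) (cliqueEmb blk x j) :=
  .inl (SimpleGraph.map_adj_apply.mpr hij)

lemma neighborSet_hiddenClique_cliqueEmb (hM : IsSideMatching blk M) (i : Fin (k + 1)) :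
    (hiddenClique blk M x).neighborSet (cliqueEmb blk x i) =
      Set.range (i.succAboveEmb.trans (cliqueEmb blk x)) := by
  ext u
  constructor
  · rintro (⟨-, i', j, hij, hi, rfl⟩ | h)
    · obtain rfl := (cliqueEmb blk x).injective hi
      obtain ⟨r, rfl⟩ := Fin.exists_succAbove_eq hij.symm
      exact ⟨r, rfl⟩
    · exact (hM.not_adj _ _ h).elim
  · rintro ⟨r, rfl⟩
    exact hiddenClique_adj_cliqueEmb_cliqueEmb (i.succAbove_ne r).symm

lemma neighborSet_hiddenClique_of_notMem_range {v : Fin n}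
    (hv : v ∉ Set.range (cliqueEmb blk x)) :
    (hiddenClique blk M x).neighborSet v = M.neighborSet v := by
  ext u
  refine ⟨?_, .inr⟩
  rintro (⟨-, i, -, -, rfl, -⟩ | h)
  · exact (hv ⟨i, rfl⟩).elim
  · exact h

lemma ncard_edgeSet_hiddenClique (hM : IsSideMatching blk M) :
    (hiddenClique blk M x).edgeSet.ncard = (k + 1).choose 2 + M.edgeSet.ncard := by
  rw [hiddenClique, ncard_edgeSet_sup, ncard_edgeSet_map_top, Fintype.card_fin]
  rw [← SimpleGraph.disjoint_edgeSet, Set.disjoint_left]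
  intro e
  induction e with
  | _ u v =>
    rintro ⟨-, i, -, -, rfl, -⟩
    exact hM.not_adj _ _

open Classical in
/-- The neighbor of `v` in `hiddenClique blk M x` that the seed `r` selects: the seed of a clique
vertex ranges over the other blocks. -/
noncomputable def seedNeighbor (blk : Fin (k + 1) × β ↪ Fin n) (M : SimpleGraph (Fin n))
    (x : Fin (k + 1) → β) (r : Fin k) (v : Fin n) : Option (Fin n) :=
  if h : v ∈ Set.range (cliqueEmb blk x) then some (cliqueEmb blk x (h.choose.succAbove r))
  else if h : ∃ u, M.Adj v u then some h.choose else none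

open Classical in
/-- The answer to a query on `hiddenClique blk M x` that the seed `r` selects. -/
noncomputable def seedAnswer (blk : Fin (k + 1) × β ↪ Fin n) (M : SimpleGraph (Fin n))
    (x : Fin (k + 1) → β) (r : Fin k) : Query n → Answer n
  | .deg v => .deg ((hiddenClique blk M x).neighborSet v).ncard
  | .neigh v => .neigh (seedNeighbor blk M x r v)
  | .indep S => .indep (decide ((hiddenClique blk M x).IsIndepSet (S : Set (Fin n))))

lemma seedNeighbor_cliqueEmb (i : Fin (k + 1)) (r : Fin k) :
    seedNeighbor blk M x r (cliqueEmb blk x i) = some (cliqueEmb blk x (i.succAbove r)) := by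
  have h : cliqueEmb blk x i ∈ Set.range (cliqueEmb blk x) := ⟨i, rfl⟩
  rw [seedNeighbor, dif_pos h, (cliqueEmb blk x).injective h.choose_spec]

lemma seedNeighbor_of_notMem_range {v : Fin n} (hv : v ∉ Set.range (cliqueEmb blk x))
    (hv' : M.neighborSet v = ∅) (r : Fin k) : seedNeighbor blk M x r v = none := by
  rw [seedNeighbor, dif_neg hv, dif_neg fun ⟨u, hu⟩ => hv'.subset hu]

lemma seedNeighbor_blk_of_notMem_range (hM : IsSideMatching blk M) {p : Fin (k + 1) × β}
    (hp : blk p ∉ Set.range (cliqueEmb blk x)) (r : Fin k) :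
    seedNeighbor blk M x r (blk p) = none :=
  seedNeighbor_of_notMem_range hp (Set.eq_empty_of_forall_notMem (hM.not_adj p)) r

lemma randomNeighbor_hiddenClique [Nonempty (Fin k)] (hM : IsSideMatching blk M) (v : Fin n) :
    randomNeighbor (hiddenClique blk M x) v =
      (PMF.uniformOfFintype (Fin k)).map fun r => seedNeighbor blk M x r v := by
  by_cases hv : v ∈ Set.range (cliqueEmb blk x)
  · obtain ⟨i, rfl⟩ := hv
    rw [randomNeighbor_of_neighborSet_eq_range _ (neighborSet_hiddenClique_cliqueEmb hM i)]
    simp only [seedNeighbor_cliqueEmb]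
    rfl
  have hneighborSet := neighborSet_hiddenClique_of_notMem_range (M := M) hv
  by_cases hu : ∃ u, M.Adj v u
  · have hsingleton : M.neighborSet v = {hu.choose} :=
      (hM.subsingleton_neighborSet v).eq_singleton_of_mem hu.choose_spec
    rw [randomNeighbor_of_neighborSet_eq_singleton (hneighborSet.trans hsingleton)]
    exact (map_eq_pure_of_forall_eq _ fun r => by rw [seedNeighbor, dif_neg hv, dif_pos hu]).symm
  · have hempty : M.neighborSet v = ∅ := by
      simpa only [Set.eq_empty_iff_forall_notMem, SimpleGraph.mem_neighborSet, not_exists] using hu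
    rw [randomNeighbor_of_neighborSet_eq_empty (hneighborSet.trans hempty)]
    exact (map_eq_pure_of_forall_eq _ (seedNeighbor_of_notMem_range hv hempty)).symm

lemma oracle_hiddenClique [Nonempty (Fin k)] (hM : IsSideMatching blk M) (q : Query n) :
    oracle (hiddenClique blk M x) q =
      (PMF.uniformOfFintype (Fin k)).map fun r => seedAnswer blk M x r q := by
  cases q with
  | deg v => exact (oracle_deg _ v).trans (map_eq_pure_of_forall_eq _ fun _ => rfl).symm
  | neigh v =>
    rw [oracle, randomNeighbor_hiddenClique hM, PMF.map_comp]
    rfl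
  | indep S => exact (map_eq_pure_of_forall_eq _ fun _ => rfl).symm

lemma exists_seedAnswer_eq_or_eq [Fintype β] (hM : IsSideMatching blk M)
    {J : Finset (Fin (k + 1))} (x₀ : Fin (k + 1) → β) {r : Fin k}
    (hr : ∀ i : Fin (k + 1), i.succAbove r ∈ J) (q : Query n) :
    ∃ a₀ a₁, ∀ x ∈ box J x₀, seedAnswer blk M x r q = a₀ ∨ seedAnswer blk M x r q = a₁ := by
  cases q with
  | deg v =>
    refine ⟨.deg k, .deg (M.neighborSet v).ncard, fun x _ => ?_⟩
    simp only [seedAnswer, Answer.deg.injEq]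
    by_cases hv : v ∈ Set.range (cliqueEmb blk x)
    · obtain ⟨i, rfl⟩ := hv
      rw [neighborSet_hiddenClique_cliqueEmb hM, ← Set.image_univ,
        Set.ncard_image_of_injective _ (Function.Embedding.injective _)]
      simp
    · exact .inr (by rw [neighborSet_hiddenClique_of_notMem_range hv])
  | neigh v =>
    by_cases hv : v ∈ Set.range blk
    · obtain ⟨⟨i, y⟩, rfl⟩ := hv
      refine ⟨.neigh (some (blk (i.succAbove r, x₀ (i.succAbove r)))), .neigh none,
        fun x hx => ?_⟩
      by_cases hp : blk (i, y) ∈ Set.range (cliqueEmb blk x)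
      · obtain rfl : y = x i := blk_mem_range_cliqueEmb_iff.mp hp
        rw [← mem_box.mp hx _ (hr i)]
        exact .inl (congrArg Answer.neigh (seedNeighbor_cliqueEmb i r))
      · exact .inr (congrArg Answer.neigh (seedNeighbor_blk_of_notMem_range hM hp r))
    · have hne (x : Fin (k + 1) → β) : v ∉ Set.range (cliqueEmb blk x) :=
        fun ⟨i, hi⟩ => hv ⟨(i, x i), hi⟩
      refine ⟨.neigh (seedNeighbor blk M x₀ r v), .neigh none, fun x _ => .inl ?_⟩
      rw [seedAnswer, seedNeighbor, seedNeighbor, dif_neg (hne x), dif_neg (hne x₀)]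
  | indep S =>
    refine ⟨.indep true, .indep false, fun x _ => ?_⟩
    simp only [seedAnswer, Answer.indep.injEq]
    exact Bool.eq_false_or_eq_true _

end HiddenClique

section Exposure

variable {n : ℕ} {G : SimpleGraph (Fin n)} {h : History n}

/-- The vertex whose neighborhood a query inspects. -/
def inspectedBy : Query n → Finset (Fin n)
  | .deg v => {v}
  | .neigh v => {v}
  | .indep _ => ∅

/-- The vertices about which a query and its answer are informative: the inspected vertex, or the
members of a set found to be independent. -/
def exposedBy : Query n × Answer n → Finset (Fin n)
  | (.deg v, _) => {v}
  | (.neigh v, _) => {v}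
  | (.indep S, .indep true) => S
  | (.indep _, _) => ∅

open Classical in
/-- The vertices inspected by the queries of a history. -/
noncomputable def inspected (h : History n) : Finset (Fin n) :=
  h.toFinset.biUnion fun p => inspectedBy p.1

open Classical in
/-- The vertices exposed by the queries of a history and their answers. -/
noncomputable def exposed (h : History n) : Finset (Fin n) := h.toFinset.biUnion exposedBy

lemma mem_inspected {v : Fin n} : v ∈ inspected h ↔ ∃ p ∈ h, v ∈ inspectedBy p.1 := by
  simp only [inspected, Finset.mem_biUnion, List.mem_toFinset]

lemma mem_exposed {v : Fin n} : v ∈ exposed h ↔ ∃ p ∈ h, v ∈ exposedBy p := by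
  simp only [exposed, Finset.mem_biUnion, List.mem_toFinset]

lemma card_inspected_le_length (h : History n) : (inspected h).card ≤ h.length := by
  classical
  calc (inspected h).card ≤ h.toFinset.card * 1 :=
        Finset.card_biUnion_le_card_mul _ _ _ fun p _ => by
          rcases p with ⟨_ | _ | _, -⟩ <;> simp [inspectedBy]
    _ ≤ h.length := (mul_one _).trans_le h.toFinset_card_le

/-- The answers recorded in `h` are possible on `G`. -/
def IsConsistent (G : SimpleGraph (Fin n)) (h : History n) : Prop :=
  ∀ p ∈ h, p.2 ∈ (oracle G p.1).support

lemma isConsistent_of_mem_support_run {A : DetAlg n} {t : ℕ} (hh : h ∈ (run A G t).support) :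
    IsConsistent G h := by
  induction t generalizing h with
  | zero => simp_all [run, IsConsistent]
  | succ t ih =>
    rw [run_succ, PMF.mem_support_bind_iff] at hh
    obtain ⟨k, hk, hkh⟩ := hh
    rcases hA : A k with q | x <;> rw [hA] at hkh
    · obtain ⟨a, ha, rfl⟩ := (PMF.mem_support_map_iff _ _ _).mp hkh
      intro p hp
      rcases List.mem_append.mp hp with hp | hp
      · exact ih hk p hp
      · obtain rfl := List.mem_singleton.mp hp
        exact ha
    · obtain rfl := (PMF.mem_support_pure_iff _ _).mp hkh
      exact ih hk

lemma exposedBy_indep_of_isIndepSet {S : Finset (Fin n)} {a : Answer n}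
    (ha : a ∈ (oracle G (.indep S)).support) (hS : G.IsIndepSet (S : Set (Fin n))) :
    exposedBy (.indep S, a) = S := by
  obtain rfl := (PMF.mem_support_pure_iff _ _).mp ha
  simp only [hS, decide_true, exposedBy]

lemma exposedBy_indep_of_not_isIndepSet {S : Finset (Fin n)} {a : Answer n}
    (ha : a ∈ (oracle G (.indep S)).support) (hS : ¬ G.IsIndepSet (S : Set (Fin n))) :
    exposedBy (.indep S, a) = ∅ := by
  obtain rfl := (PMF.mem_support_pure_iff _ _).mp ha
  simp only [hS, decide_false, exposedBy]

lemma card_filter_mem_exposedBy_le_one {ι : Type*} [Fintype ι] {f : ι ↪ Fin n}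
    (hf : (⊤ : SimpleGraph ι).map f ≤ G) {p : Query n × Answer n}
    (hp : p.2 ∈ (oracle G p.1).support) :
    (Finset.univ.filter fun i => f i ∈ exposedBy p).card ≤ 1 := by
  rw [Finset.card_le_one]
  intro i hi j hj
  rw [Finset.mem_filter_univ] at hi hj
  obtain ⟨_ | _ | S, a⟩ := p
  · exact f.injective ((Finset.mem_singleton.mp hi).trans (Finset.mem_singleton.mp hj).symm)
  · exact f.injective ((Finset.mem_singleton.mp hi).trans (Finset.mem_singleton.mp hj).symm)
  · by_cases hS : G.IsIndepSet (S : Set (Fin n))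
    · rw [exposedBy_indep_of_isIndepSet hp hS] at hi hj
      by_contra hij
      exact hS hi hj (f.injective.ne hij) (hf (SimpleGraph.map_adj_apply.mpr hij))
    · rw [exposedBy_indep_of_not_isIndepSet hp hS] at hi
      simp at hi

lemma IsConsistent.card_filter_mem_exposed_le {ι : Type*} [Fintype ι] (hh : IsConsistent G h)
    {f : ι ↪ Fin n} (hf : (⊤ : SimpleGraph ι).map f ≤ G) :
    (Finset.univ.filter fun i => f i ∈ exposed h).card ≤ h.length := by
  classical
  have hbiUnion : (Finset.univ.filter fun i => f i ∈ exposed h) =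
      h.toFinset.biUnion fun p => Finset.univ.filter fun i => f i ∈ exposedBy p := by
    ext i
    simp [mem_exposed]
  calc _ ≤ h.toFinset.card * 1 := hbiUnion ▸ Finset.card_biUnion_le_card_mul _ _ _ fun p hp =>
        card_filter_mem_exposedBy_le_one hf (hh p (List.mem_toFinset.mp hp))
    _ ≤ h.length := (mul_one _).trans_le h.toFinset_card_le

lemma neighborSet_sup_between_of_notMem {T L : Set (Fin n)} {v : Fin n} (hT : v ∉ T) (hL : v ∉ L) :
    G.neighborSet v = (G ⊔ (⊤ : SimpleGraph (Fin n)).between T L).neighborSet v := by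
  ext u
  simp [SimpleGraph.between_adj, hT, hL]

lemma isIndepSet_sup_between_iff {S T L : Set (Fin n)} (hS : G.IsIndepSet S → Disjoint S T) :
    G.IsIndepSet S ↔ (G ⊔ (⊤ : SimpleGraph (Fin n)).between T L).IsIndepSet S := by
  refine ⟨fun h u hu v hv huv hadj => ?_, fun h u hu v hv huv hadj => h hu hv huv (.inl hadj)⟩
  rcases hadj with hadj | ⟨-, ⟨huT, -⟩ | ⟨-, hvT⟩⟩
  · exact h hu hv huv hadj
  · exact Set.disjoint_left.mp (hS h) hu huT
  · exact Set.disjoint_left.mp (hS h) hv hvT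

lemma oracle_sup_between_eq {T L : Set (Fin n)} {p : Query n × Answer n}
    (hp : p.2 ∈ (oracle G p.1).support) (hT : ∀ v ∈ exposedBy p, v ∉ T)
    (hL : ∀ v ∈ inspectedBy p.1, v ∉ L) :
    oracle G p.1 = oracle (G ⊔ (⊤ : SimpleGraph (Fin n)).between T L) p.1 := by
  obtain ⟨v | v | S, a⟩ := p
  · exact oracle_deg_congr (neighborSet_sup_between_of_notMem
      (hT v (Finset.mem_singleton_self v)) (hL v (Finset.mem_singleton_self v)))
  · exact oracle_neigh_congr (neighborSet_sup_between_of_notMem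
      (hT v (Finset.mem_singleton_self v)) (hL v (Finset.mem_singleton_self v)))
  · refine oracle_indep_congr (isIndepSet_sup_between_iff fun hS => ?_)
    rw [exposedBy_indep_of_isIndepSet hp hS] at hT
    exact Set.disjoint_left.mpr hT

lemma IsConsistent.exposed_or_inspected_of_mem_distinguishing {T L : Set (Fin n)}
    (hh : IsConsistent G h)
    (hd : h ∈ distinguishing G (G ⊔ (⊤ : SimpleGraph (Fin n)).between T L)) :
    (∃ v ∈ exposed h, v ∈ T) ∨ ∃ v ∈ inspected h, v ∈ L := by
  obtain ⟨p, hp, hne⟩ := hd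
  by_contra! hcon
  exact hne (oracle_sup_between_eq (hh p hp)
    (fun v hv => hcon.1 v (mem_exposed.mpr ⟨p, hp, hv⟩))
    fun v hv => hcon.2 v (mem_inspected.mpr ⟨p, hp, hv⟩))

end Exposure

section Planting

variable {n k : ℕ} {α β δ ρ σ : Type*} {blk : Fin (k + 1) × β ↪ Fin n} {M : SimpleGraph (Fin n)}
  {x : Fin (k + 1) → β} {A : DetAlg n} {h : History n}

/-- The graph `hiddenClique blk M x`, with a complete bipartite graph planted between the cell `a`
of the block vertices and the cell `c` of further vertices, where `i = (x, a, c)`. -/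
def planted (blk : Fin (k + 1) × β ↪ Fin n) (M : SimpleGraph (Fin n))
    (τ : α × ρ ↪ Fin (k + 1) × β) (lam : δ × σ ↪ Fin n) (i : (Fin (k + 1) → β) × α × δ) :
    SimpleGraph (Fin n) :=
  hiddenClique blk M i.1 ⊔ (⊤ : SimpleGraph (Fin n)).between
    (Set.range (cell (τ.trans blk) i.2.1)) (Set.range (cell lam i.2.2))

/-- The block vertices exposed in a history. -/
noncomputable def exposedBlock (blk : Fin (k + 1) × β ↪ Fin n) (h : History n) :
    Finset (Fin (k + 1) × β) :=
  (exposed h).preimage blk blk.injective.injOn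

lemma IsConsistent.card_hits_exposedBlock_le [DecidableEq β]
    (hh : IsConsistent (hiddenClique blk M x) h) :
    (hits (exposedBlock blk h) x).card ≤ h.length := by
  refine le_of_eq_of_le (congrArg Finset.card ?_)
    (hh.card_filter_mem_exposed_le (f := cliqueEmb blk x) le_sup_left)
  ext j
  simp only [hits, exposedBlock, Finset.mem_filter_univ, Finset.mem_preimage]
  rfl

lemma exists_finset_forall_succAbove_mem (l : List (Fin k)) :
    ∃ J : Finset (Fin (k + 1)), J.card ≤ 2 * l.length ∧
      ∀ r ∈ l, ∀ i : Fin (k + 1), i.succAbove r ∈ J := by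
  refine ⟨l.toFinset.image Fin.castSucc ∪ l.toFinset.image Fin.succ, ?_, fun r hr i => ?_⟩
  · calc _ ≤ l.toFinset.card + l.toFinset.card :=
          (Finset.card_union_le _ _).trans (add_le_add Finset.card_image_le Finset.card_image_le)
      _ ≤ 2 * l.length := by
          rw [← two_mul]
          gcongr
          exact l.toFinset_card_le
  · rw [Finset.mem_union, Finset.mem_image, Finset.mem_image]
    unfold Fin.succAbove
    split_ifs
    · exact .inl ⟨r, List.mem_toFinset.mpr hr, rfl⟩
    · exact .inr ⟨r, List.mem_toFinset.mpr hr, rfl⟩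

lemma mul_card_filter_many_exposed_le [Fintype β] [Nonempty β] (hM : IsSideMatching blk M)
    {l : List (Fin k)} (hl : 0 < l.length)
    (hh : ∀ x, IsConsistent (hiddenClique blk M x) (seededRun A (seedAnswer blk M x) l))
    (hlength : ∀ x, (seededRun A (seedAnswer blk M x) l).length ≤ l.length) :
    36 * (Finset.univ.filter fun x => 12 * l.length * Fintype.card β ≤
      (exposedBlock blk (seededRun A (seedAnswer blk M x) l)).card).card ≤
        Fintype.card (Fin (k + 1) → β) := by
  classical
  obtain ⟨J, hJ, hJl⟩ := exists_finset_forall_succAbove_mem l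
  exact mul_card_filter_large_le_card hl hJ (fun x => seededRun A (seedAnswer blk M x) l)
    (fun x₀ => ncard_image_seededRun_le _ (Finset.finite_toSet _) fun r hr =>
      exists_seedAnswer_eq_or_eq hM x₀ (hJl r hr))
    (exposedBlock blk) fun x => (hh x).card_hits_exposedBlock_le.trans (hlength x)

lemma IsConsistent.ncard_mem_distinguishing_planted_le [Fintype α] [Fintype δ]
    {τ : α × ρ ↪ Fin (k + 1) × β} {lam : δ × σ ↪ Fin n}
    (hh : IsConsistent (hiddenClique blk M x) h) :
    {y : α × δ | h ∈ distinguishing (hiddenClique blk M x) (planted blk M τ lam (x, y))}.ncard ≤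
      (exposedBlock blk h).card * Fintype.card δ + Fintype.card α * h.length := by
  let S : Set α := {a | ∃ p ∈ exposedBlock blk h, p ∈ Set.range (cell τ a)}
  let T : Set δ := {c | ∃ v ∈ inspected h, v ∈ Set.range (cell lam c)}
  have hsubset : {y : α × δ | h ∈ distinguishing (hiddenClique blk M x)
      (planted blk M τ lam (x, y))} ⊆ S ×ˢ Set.univ ∪ Set.univ ×ˢ T := by
    rintro ⟨a, c⟩ hd
    refine (hh.exposed_or_inspected_of_mem_distinguishing hd).imp ?_ fun hc => ⟨trivial, hc⟩
    rintro ⟨_, hv, i, rfl⟩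
    exact ⟨⟨_, Finset.mem_preimage.mpr hv, i, rfl⟩, trivial⟩
  calc _ ≤ (S ×ˢ Set.univ ∪ Set.univ ×ˢ T).ncard := Set.ncard_le_ncard hsubset
    _ ≤ S.ncard * Fintype.card δ + Fintype.card α * T.ncard := by
      refine (Set.ncard_union_le _ _).trans_eq ?_
      simp only [Set.ncard_prod, Set.ncard_univ, Nat.card_eq_fintype_card]
    _ ≤ _ := by
      gcongr
      · exact ncard_cells_meeting_le τ _
      · exact (ncard_cells_meeting_le lam _).trans (card_inspected_le_length h)

lemma mul_ncard_le_of_mul_card_filter_le {ξ η : Type*} [Fintype ξ] [Fintype η]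
    {P : Set (ξ × η)} {F : ξ → Prop} [DecidablePred F] {c : ℕ}
    (hF : 36 * (Finset.univ.filter F).card ≤ Fintype.card ξ)
    (hP : ∀ x, ¬ F x → {y | (x, y) ∈ P}.ncard ≤ c) (hc : 36 * c ≤ 2 * Fintype.card η) :
    12 * P.ncard ≤ Fintype.card (ξ × η) := by
  classical
  have hfiber (x : ξ) : {y | (x, y) ∈ P}.ncard ≤ (if F x then Fintype.card η else 0) + c := by
    split_ifs with hx
    · exact (Nat.card_eq_fintype_card (α := η) ▸ Set.ncard_le_card _).trans le_self_add
    · exact (hP x hx).trans_eq (zero_add c).symm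
  have hsum : P.ncard = ∑ x, {y | (x, y) ∈ P}.ncard := by
    simp only [Set.ncard_eq_toFinset_card', Set.toFinset_ofPred, Finset.card_filter]
    rw [← Fintype.sum_prod_type fun p => if p ∈ P then 1 else 0, ← Finset.card_filter]
    congr 1
    ext
    simp
  have htotal : P.ncard ≤
      (Finset.univ.filter F).card * Fintype.card η + Fintype.card ξ * c := by
    rw [hsum]
    refine (Finset.sum_le_sum fun x _ => hfiber x).trans_eq ?_
    rw [Finset.sum_add_distrib, ← Finset.sum_filter, Finset.sum_const, Finset.sum_const,
      smul_eq_mul, smul_eq_mul, Finset.card_univ]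
  rw [Fintype.card_prod]
  nlinarith [Nat.mul_le_mul_right (Fintype.card η) hF, Nat.mul_le_mul_left (Fintype.card ξ) hc]

lemma sum_distinguishing_planted_le [Nonempty (Fin k)] [Fintype α] [Fintype β] [Nonempty β]
    [Fintype δ] {τ : α × ρ ↪ Fin (k + 1) × β} {lam : δ × σ ↪ Fin n} (hM : IsSideMatching blk M)
    {q : ℕ} (hq : 0 < q) (hα : 36 * (12 * q * Fintype.card β) ≤ Fintype.card α)
    (hδ : 36 * q ≤ Fintype.card δ) :
    ∑ i : (Fin (k + 1) → β) × α × δ, (run A (hiddenClique blk M i.1) q).toOuterMeasure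
        (distinguishing (hiddenClique blk M i.1) (planted blk M τ lam i)) ≤
      (Fintype.card ((Fin (k + 1) → β) × α × δ) : ℝ≥0∞) / 12 := by
  classical
  have hrun (x : Fin (k + 1) → β) : run A (hiddenClique blk M x) q =
      (seedLaw (PMF.uniformOfFintype (Fin k)) q).map (seededRun A (seedAnswer blk M x)) :=
    run_eq_map_seededRun (oracle_hiddenClique hM) q
  simp only [hrun, PMF.toOuterMeasure_map_apply]
  refine sum_toOuterMeasure_le _ _ fun l hl => ?_
  have hsupport (x : Fin (k + 1) → β) : seededRun A (seedAnswer blk M x) l ∈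
      (run A (hiddenClique blk M x) q).support :=
    hrun x ▸ (PMF.mem_support_map_iff _ _ _).mpr ⟨l, hl, rfl⟩
  have hconsistent (x : Fin (k + 1) → β) := isConsistent_of_mem_support_run (hsupport x)
  have hlength (x : Fin (k + 1) → β) := (length_of_mem_support_run (hsupport x)).1
  obtain rfl := length_of_mem_support_seedLaw hl
  rw [ENNReal.le_div_iff_mul_le (by simp) (by simp), mul_comm]
  have hcount := mul_ncard_le_of_mul_card_filter_le
    (P := {i | seededRun A (seedAnswer blk M i.1) l ∈
      distinguishing (hiddenClique blk M i.1) (planted blk M τ lam i)})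
    (c := 12 * l.length * Fintype.card β * Fintype.card δ + Fintype.card α * l.length)
    (mul_card_filter_many_exposed_le hM hq hconsistent hlength)
    (fun x hx => (hconsistent x).ncard_mem_distinguishing_planted_le.trans (by
      gcongr
      · exact (not_le.mp hx).le
      · exact hlength x))
    (by
      rw [Fintype.card_prod]
      nlinarith [Nat.mul_le_mul_right (Fintype.card δ) hα,
        Nat.mul_le_mul_left (Fintype.card α) hδ])
  exact_mod_cast hcount

end Planting

section SideMatching

variable {n r : ℕ}

/-- The perfect matching of the vertices `e (i, false)` with the vertices `e (i, true)`. -/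
def sideMatching (e : Fin r × Bool ↪ Fin n) : SimpleGraph (Fin n) where
  Adj u v := ∃ i s, e (i, s) = u ∧ e (i, !s) = v
  symm := ⟨by
    rintro _ _ ⟨i, s, rfl, rfl⟩
    exact ⟨i, !s, rfl, by rw [Bool.not_not]⟩⟩
  loopless := ⟨by
    rintro _ ⟨i, s, hs, hs'⟩
    exact Bool.not_ne_self s (Prod.mk.inj (e.injective (hs'.trans hs.symm))).2⟩

lemma subsingleton_neighborSet_sideMatching (e : Fin r × Bool ↪ Fin n) (v : Fin n) :
    ((sideMatching e).neighborSet v).Subsingleton := by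
  rintro _ ⟨i, s, rfl, rfl⟩ _ ⟨j, t, h, rfl⟩
  obtain ⟨rfl, rfl⟩ := Prod.mk.inj (e.injective h)
  rfl

lemma edgeSet_sideMatching (e : Fin r × Bool ↪ Fin n) :
    (sideMatching e).edgeSet = Set.range fun i => s(e (i, false), e (i, true)) := by
  ext z
  induction z with
  | _ u v =>
    constructor
    · rintro ⟨i, _ | _, rfl, rfl⟩
      · exact ⟨i, rfl⟩
      · exact ⟨i, Sym2.eq_swap⟩
    · rintro ⟨i, hi⟩
      rcases Sym2.eq_iff.mp hi with ⟨rfl, rfl⟩ | ⟨rfl, rfl⟩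
      · exact ⟨i, false, rfl, rfl⟩
      · exact ⟨i, true, rfl, rfl⟩

lemma ncard_edgeSet_sideMatching (e : Fin r × Bool ↪ Fin n) :
    (sideMatching e).edgeSet.ncard = r := by
  have hinjective : Function.Injective fun i => s(e (i, false), e (i, true)) := by
    intro i j hij
    rcases Sym2.eq_iff.mp hij with ⟨h, -⟩ | ⟨h, -⟩ <;>
      exact (Prod.mk.inj (e.injective h)).1
  rw [edgeSet_sideMatching, Set.ncard_range_of_injective hinjective, Nat.card_fin]

end SideMatching

section PlantingBound

variable {n k : ℕ}

lemma ncard_edgeSet_planted {α β δ ρ σ : Type*} {blk : Fin (k + 1) × β ↪ Fin n}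
    {M : SimpleGraph (Fin n)} {τ : α × ρ ↪ Fin (k + 1) × β} {lam : δ × σ ↪ Fin n}
    (hlam : Disjoint (Set.range blk) (Set.range lam)) (hM : ∀ p v, ¬ M.Adj (lam p) v)
    (i : (Fin (k + 1) → β) × α × δ) :
    (planted blk M τ lam i).edgeSet.ncard =
      (hiddenClique blk M i.1).edgeSet.ncard + Nat.card ρ * Nat.card σ := by
  have hcells : Disjoint (Set.range (cell (τ.trans blk) i.2.1))
      (Set.range (cell lam i.2.2)) := by
    refine hlam.mono ?_ ?_
    · rintro _ ⟨j, rfl⟩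
      exact ⟨_, rfl⟩
    · rintro _ ⟨j, rfl⟩
      exact ⟨_, rfl⟩
  have hnot_adj (p : δ × σ) (v : Fin n) : ¬ (hiddenClique blk M i.1).Adj (lam p) v := by
    rintro (⟨-, j, -, -, hj, -⟩ | h)
    · exact Set.disjoint_left.mp hlam ⟨_, hj⟩ ⟨p, rfl⟩
    · exact hM p v h
  rw [planted, ncard_edgeSet_sup, ncard_edgeSet_between_top hcells,
    Set.ncard_range_of_injective (Function.Embedding.injective _),
    Set.ncard_range_of_injective (Function.Embedding.injective _)]
  rw [← SimpleGraph.disjoint_edgeSet, Set.disjoint_left]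
  intro e
  induction e with
  | _ u v =>
    rintro h ⟨-, ⟨-, j, rfl⟩ | ⟨⟨j, rfl⟩, -⟩⟩
    · exact hnot_adj _ _ h.symm
    · exact hnot_adj _ _ h

lemma exists_disjoint_blocks_cells_sideMatching {b B l r : ℕ}
    (hn : (k + 1) * b + B * l + r * 2 ≤ n) :
    ∃ (blk : Fin (k + 1) × Fin b ↪ Fin n) (lam : Fin B × Fin l ↪ Fin n)
      (M : SimpleGraph (Fin n)), IsSideMatching blk M ∧ M.edgeSet.ncard = r ∧
        Disjoint (Set.range blk) (Set.range lam) ∧ ∀ p v, ¬ M.Adj (lam p) v := by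
  obtain ⟨f⟩ : Nonempty ((Fin (k + 1) × Fin b) ⊕ (Fin B × Fin l) ⊕ (Fin r × Bool) ↪ Fin n) :=
    Function.Embedding.nonempty_of_card_le (by simpa [add_assoc] using hn)
  let e : Fin r × Bool ↪ Fin n :=
    (Function.Embedding.inr.trans Function.Embedding.inr).trans f
  refine ⟨Function.Embedding.inl.trans f,
    (Function.Embedding.inl.trans Function.Embedding.inr).trans f, sideMatching e,
    ⟨subsingleton_neighborSet_sideMatching e, ?_⟩, ncard_edgeSet_sideMatching e, ?_, ?_⟩
  · rintro p v ⟨i, s, h, -⟩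
    cases f.injective h
  · rw [Set.disjoint_left]
    rintro _ ⟨p, rfl⟩ ⟨p', h⟩
    cases f.injective h
  · rintro p v ⟨i, s, h, -⟩
    cases f.injective h

lemma RandAlg.EstimatesEdges.exists_le_expectedQueries_of_planting {Ω : Type*}
    [MeasurableSpace Ω] {μ : MeasureTheory.Measure Ω} [MeasureTheory.IsProbabilityMeasure μ]
    {A : RandAlg n Ω} {ε : ℝ} (hA : A.EstimatesEdges μ ε) {m q r b t l : ℕ} (hk : 0 < k)
    (hq : 0 < q) (hb : 0 < b) (hm : (k + 1).choose 2 + r = m)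
    (ht : 36 * (12 * q) * t ≤ k + 1) (hn : (k + 1) * b + 36 * q * l + r * 2 ≤ n)
    (hgap : (1 + ε) * m < (1 - ε) * (m + t * l)) :
    ∃ G : SimpleGraph (Fin n), G.edgeSet.ncard = m ∧
      ((q : ℝ≥0∞) + 1) / 4 ≤ A.expectedQueries μ G := by
  obtain ⟨blk, lam, M, hM, hMr, hlam, hMlam⟩ := exists_disjoint_blocks_cells_sideMatching hn
  obtain ⟨τ⟩ : Nonempty (Fin (36 * (12 * q * b)) × Fin t ↪ Fin (k + 1) × Fin b) := by
    refine Function.Embedding.nonempty_of_card_le ?_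
    simp only [Fintype.card_prod, Fintype.card_fin]
    calc 36 * (12 * q * b) * t = 36 * (12 * q) * t * b := by ring
      _ ≤ (k + 1) * b := by gcongr
  have hcard (x : Fin (k + 1) → Fin b) : (hiddenClique blk M x).edgeSet.ncard = m := by
    rw [ncard_edgeSet_hiddenClique hM, hMr, hm]
  have hdisjoint (i : (Fin (k + 1) → Fin b) × Fin (36 * (12 * q * b)) × Fin (36 * q)) :
      Disjoint (accurateOutputs ε (hiddenClique blk M i.1))
        (accurateOutputs ε (planted blk M τ lam i)) := by
    apply disjoint_accurateOutputs
    rw [ncard_edgeSet_planted hlam hMlam, hcard, Nat.card_fin, Nat.card_fin]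
    exact_mod_cast hgap
  have : Nonempty (Fin k) := ⟨⟨0, hk⟩⟩
  have : Nonempty (Fin b) := ⟨⟨0, hb⟩⟩
  have : Nonempty (Fin (36 * (12 * q * b))) := ⟨⟨0, by positivity⟩⟩
  have : Nonempty (Fin (36 * q)) := ⟨⟨0, by positivity⟩⟩
  obtain ⟨i, hi⟩ := hA.exists_le_expectedQueries hdisjoint fun _ =>
    sum_distinguishing_planted_le hM hq (by simp only [Fintype.card_fin, le_refl])
      (by simp only [Fintype.card_fin, le_refl])
  exact ⟨_, hcard i.1, hi⟩

end PlantingBound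

section Parameters

lemma succ_choose_two (k : ℕ) : (k + 1).choose 2 = k.choose 2 + k := by
  rw [Nat.choose_succ_succ' k 1, Nat.choose_one_right, add_comm]

lemma exists_choose_two_le_and_lt {m : ℕ} (hm : 0 < m) :
    ∃ k, 0 < k ∧ (k + 1).choose 2 ≤ m ∧ m < (k + 2).choose 2 := by
  have hmono : StrictMono fun j => (j + 2).choose 2 :=
    strictMono_nat_of_lt_succ fun j => by rw [succ_choose_two (j + 2)]; omega
  obtain ⟨j, hj, hj'⟩ :=
    hmono.exists_between_of_tendsto_atTop hmono.tendsto_atTop (x := m + 1) (by simpa using hm)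
  exact ⟨j + 1, j.succ_pos, Nat.lt_succ_iff.mp hj, hj'⟩

lemma le_two_mul_mul_div {a d : ℕ} (hd : 0 < d) (hda : d ≤ a) : a ≤ 2 * d * (a / d) := by
  have hpos : 0 < a / d := Nat.div_pos hda hd
  have hlt : a < d * (a / d + 1) := Nat.lt_mul_div_succ a hd
  nlinarith

lemma sq_le_four_mul_choose_two {z : ℕ} (hz : 2 ≤ z) : z ^ 2 ≤ 4 * z.choose 2 := by
  obtain ⟨y, rfl⟩ := Nat.exists_eq_add_of_le' hz
  have htwo : 2 * (y + 2).choose 2 = (y + 2) * (y + 1) := by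
    rw [Nat.choose_two_right, Nat.mul_div_cancel' (Nat.even_mul_pred_self _).two_dvd]
    rfl
  nlinarith

lemma sqrt_le_of_lt_choose_two {m k : ℕ} (hm : m < (k + 2).choose 2) : √(m : ℝ) ≤ k + 1 := by
  rw [Real.sqrt_le_left (by positivity)]
  have hchoose : (m : ℝ) ≤ ((k + 2).choose 2 : ℕ) := by exact_mod_cast hm.le
  rw [Nat.cast_choose_two] at hchoose
  push_cast at hchoose
  nlinarith [Nat.cast_nonneg (α := ℝ) k]

/-- The numbers `n` of vertices, `m` of edges and `q` of queries, the accuracy `ε`, and the number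
`k + 1` of vertices of the largest clique with at most `m` edges, when `q` is small enough for both
constructions. The last field is the bound `q ≤ √((1 - ε) * n / (ε * √m)) / 1000` without its
divisions. -/
structure Admissible (n m k q : ℕ) (ε : ℝ) : Prop where
  eps_pos : 0 < ε
  eps_lt_one : ε < 1
  k_pos : 0 < k
  q_pos : 0 < q
  choose_le : (k + 1).choose 2 ≤ m
  lt_choose : m < (k + 2).choose 2
  mul_q_le : 1000 * q ≤ k + 1
  q_sq_le : 10 ^ 6 * (q ^ 2 * (ε * √m)) ≤ (1 - ε) * n

variable {n m k q : ℕ} {ε : ℝ}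

lemma Admissible.q_sq_mul_le (h : Admissible n m k q ε) :
    10 ^ 6 * (q ^ 2 * (ε * m)) ≤ (1 - ε) * (n * (k + 1)) := by
  have hε := sub_pos.mpr h.eps_lt_one
  calc 10 ^ 6 * (q ^ 2 * (ε * m)) = 10 ^ 6 * (q ^ 2 * (ε * √m)) * √m := by
        nth_rw 1 [← Real.mul_self_sqrt (Nat.cast_nonneg m)]
        ring
    _ ≤ (1 - ε) * n * (k + 1) :=
        mul_le_mul h.q_sq_le (sqrt_le_of_lt_choose_two h.lt_choose) (Real.sqrt_nonneg _)
          (by positivity)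
    _ = (1 - ε) * (n * (k + 1)) := by ring

lemma Admissible.two_mul_eps_mul_lt_choose (h : Admissible n m k q ε) (hn : n < 6 * (k + 1)) :
    2 * (ε * m) < ((k + 1) / (12 * q)).choose 2 := by
  have hq := h.q_pos
  have hkq := h.mul_q_le
  have hε := h.eps_pos
  have hk := le_two_mul_mul_div (a := k + 1) (d := 12 * q) (by omega) (by omega)
  have hz : 2 ≤ (k + 1) / (12 * q) := (Nat.le_div_iff_mul_le (by omega)).mpr (by omega)
  set z := (k + 1) / (12 * q)
  have hchoose : (z : ℝ) ^ 2 ≤ 4 * z.choose 2 := by exact_mod_cast sq_le_four_mul_choose_two hz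
  have hsize : (k + 1 : ℝ) ≤ 24 * q * z := by exact_mod_cast hk.trans_eq (by ring)
  have hn' : (n : ℝ) ≤ 6 * (k + 1) := by exact_mod_cast hn.le
  have hmain : 10 ^ 6 * (q ^ 2 * (ε * m)) ≤ 13824 * (q ^ 2 * (z.choose 2 : ℝ)) :=
    calc 10 ^ 6 * (q ^ 2 * (ε * m)) ≤ (1 - ε) * (n * (k + 1)) := h.q_sq_mul_le
      _ ≤ 1 * (6 * (k + 1) * (k + 1)) := by
        gcongr
        linarith
      _ = 6 * (k + 1 : ℝ) ^ 2 := by ring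
      _ ≤ 6 * (24 * q * z : ℝ) ^ 2 := by gcongr
      _ = 3456 * (q ^ 2 * (z : ℝ) ^ 2) := by ring
      _ ≤ 3456 * (q ^ 2 * (4 * z.choose 2 : ℝ)) := by gcongr
      _ = 13824 * (q ^ 2 * (z.choose 2 : ℝ)) := by ring
  have hpos : (0 : ℝ) < q ^ 2 * (z.choose 2 : ℝ) := by
    have := Nat.choose_pos hz
    positivity
  refine lt_of_mul_lt_mul_left (a := (q : ℝ) ^ 2) ?_ (by positivity)
  linarith

lemma Admissible.two_mul_eps_mul_lt_mul (h : Admissible n m k q ε) (hn : 6 * (k + 1) ≤ n) :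
    2 * (ε * m) < (1 - ε) *
      (((k + 1) / (36 * (12 * q)) : ℕ) * (n / 3 / (36 * q) : ℕ)) := by
  have hq := h.q_pos
  have hkq := h.mul_q_le
  have hε := sub_pos.mpr h.eps_lt_one
  have hk := le_two_mul_mul_div (a := k + 1) (d := 36 * (12 * q)) (by omega) (by omega)
  have hn3 := le_two_mul_mul_div (a := n / 3) (d := 36 * q) (by omega) (by omega)
  set t := (k + 1) / (36 * (12 * q))
  set l := n / 3 / (36 * q)
  have ht : (k + 1 : ℝ) ≤ 864 * q * t := by exact_mod_cast hk.trans_eq (by ring)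
  have hl : (n : ℝ) ≤ 288 * q * l := by
    have hn4 : n ≤ 4 * (n / 3) := by omega
    exact_mod_cast (hn4.trans (Nat.mul_le_mul_left 4 hn3)).trans_eq (by ring)
  have hsize : (n * (k + 1) : ℝ) ≤ 248832 * (q ^ 2 * (t * l)) :=
    calc (n * (k + 1) : ℝ) ≤ 288 * q * l * (864 * q * t) := by gcongr
      _ = 248832 * (q ^ 2 * (t * l)) := by ring
  have hmain : 10 ^ 6 * (q ^ 2 * (ε * m)) ≤ 248832 * (q ^ 2 * ((1 - ε) * (t * l))) :=
    calc 10 ^ 6 * (q ^ 2 * (ε * m)) ≤ (1 - ε) * (n * (k + 1)) := h.q_sq_mul_le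
      _ ≤ (1 - ε) * (248832 * (q ^ 2 * (t * l))) := by gcongr
      _ = 248832 * (q ^ 2 * ((1 - ε) * (t * l))) := by ring
  have hpos : 0 < q ^ 2 * ((1 - ε) * (t * l)) := by
    have hn0 : (0 : ℝ) < n := by exact_mod_cast (by omega : 0 < n)
    have : (0 : ℝ) < q ^ 2 * (t * l) := by linarith [mul_pos hn0 k.cast_add_one_pos]
    linarith [mul_pos hε this]
  refine lt_of_mul_lt_mul_left (a := (q : ℝ) ^ 2) ?_ (by positivity)
  linarith

section Estimation

variable {Ω : Type*} [MeasurableSpace Ω] {μ : MeasureTheory.Measure Ω}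
  [MeasureTheory.IsProbabilityMeasure μ] {A : RandAlg n Ω}

lemma Admissible.exists_le_expectedQueries_of_dense (h : Admissible n m k q ε)
    (hA : A.EstimatesEdges μ ε) (hm : m ≤ n.choose 2) (hn : n < 6 * (k + 1)) :
    ∃ G : SimpleGraph (Fin n), G.edgeSet.ncard = m ∧
      ((q : ℝ≥0∞) + 1) / 4 ≤ A.expectedQueries μ G := by
  have hkn : k + 1 ≤ n := by
    by_contra! hlt
    have hle : n.choose 2 ≤ k.choose 2 := Nat.choose_le_choose 2 (Nat.lt_succ_iff.mp hlt)
    have := h.choose_le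
    have := h.k_pos
    rw [succ_choose_two] at *
    omega
  refine hA.exists_le_expectedQueries_of_removal h.q_pos (Nat.mul_div_le _ _) hkn h.choose_le hm
    fun m' hm' => ?_
  have hgap := h.two_mul_eps_mul_lt_choose hn
  rw [← hm'] at hgap ⊢
  push_cast at hgap ⊢
  nlinarith [h.eps_pos]

lemma Admissible.exists_le_expectedQueries_of_sparse (h : Admissible n m k q ε)
    (hA : A.EstimatesEdges μ ε) (hn : 6 * (k + 1) ≤ n) :
    ∃ G : SimpleGraph (Fin n), G.edgeSet.ncard = m ∧
      ((q : ℝ≥0∞) + 1) / 4 ≤ A.expectedQueries μ G := by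
  have hle := h.choose_le
  have hlt := h.lt_choose
  have hblocks := Nat.mul_div_le (n / 3) (k + 1)
  have hcells := Nat.mul_div_le (n / 3) (36 * q)
  rw [succ_choose_two (k + 1)] at hlt
  refine hA.exists_le_expectedQueries_of_planting h.k_pos h.q_pos (b := n / 3 / (k + 1))
    (Nat.div_pos (by omega) k.succ_pos) (Nat.add_sub_cancel' hle) (Nat.mul_div_le _ _)
    (l := n / 3 / (36 * q)) (by omega) ?_
  linarith [h.two_mul_eps_mul_lt_mul hn]

lemma RandAlg.EstimatesEdges.exists_one_fourth_le_expectedQueries (hA : A.EstimatesEdges μ ε)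
    (hε : ε < 1) (hm₀ : 0 < m) (hm : m ≤ n.choose 2) :
    ∃ G : SimpleGraph (Fin n), G.edgeSet.ncard = m ∧ 1 / 4 ≤ A.expectedQueries μ G := by
  obtain ⟨G, -, hG⟩ := exists_ge_ncard_edgeSet_eq (⊥ : SimpleGraph (Fin n)) (m := m)
    (by simp) (by simpa using hm)
  have hdisjoint :
      Disjoint (accurateOutputs ε G) (accurateOutputs ε (⊥ : SimpleGraph (Fin n))) := by
    refine (disjoint_accurateOutputs ?_).symm
    simpa [hG] using mul_pos (sub_pos.mpr hε) (Nat.cast_pos.mpr hm₀)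
  have hquarter := hA.le_expectedQueries hdisjoint (q := 0)
    (by simp [run, PMF.toOuterMeasure_pure_apply, distinguishing])
  exact ⟨G, hG, by simpa using hquarter⟩

lemma exists_admissible (hε : 0 < ε) (hε' : ε < 1) (hm : 0 < m) (hq : 0 < q)
    (hqm : (q : ℝ) ≤ √(1 - ε) / 1000 * min √m √(n / (ε * √m))) :
    ∃ k, Admissible n m k q ε := by
  obtain ⟨k, hk, hle, hlt⟩ := exists_choose_two_le_and_lt hm
  refine ⟨k, hε, hε', hk, hq, hle, hlt, ?_, ?_⟩
  · have hqk : (q : ℝ) ≤ 1 / 1000 * (k + 1) :=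
      calc (q : ℝ) ≤ √(1 - ε) / 1000 * min √m √(n / (ε * √m)) := hqm
        _ ≤ 1 / 1000 * (k + 1) := by
          gcongr
          · exact Real.sqrt_le_one.mpr (by linarith)
          · exact (min_le_left _ _).trans (sqrt_le_of_lt_choose_two hlt)
    have : (1000 * q : ℝ) ≤ k + 1 := by linarith
    exact_mod_cast this
  · have : 0 < √(m : ℝ) := Real.sqrt_pos.mpr (Nat.cast_pos.mpr hm)
    calc 10 ^ 6 * (q ^ 2 * (ε * √m))
        ≤ 10 ^ 6 * ((√(1 - ε) / 1000 * √(n / (ε * √m))) ^ 2 * (ε * √m)) := by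
          gcongr
          exact hqm.trans (by gcongr; exact min_le_right _ _)
      _ = 10 ^ 6 * (((1 - ε) / 1000 ^ 2 * (n / (ε * √m))) * (ε * √m)) := by
          rw [mul_pow, div_pow, Real.sq_sqrt (sub_nonneg.mpr hε'.le), Real.sq_sqrt (by positivity)]
      _ = (1 - ε) * n := by
          field_simp
          ring

lemma RandAlg.EstimatesEdges.exists_sqrt_mul_min_le_expectedQueries (hA : A.EstimatesEdges μ ε)
    (hε : 0 < ε) (hε' : ε < 1) (hm : m ≤ n.choose 2) :
    ∃ G : SimpleGraph (Fin n), G.edgeSet.ncard = m ∧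
      ENNReal.ofReal (√(1 - ε) / 4000 * min √m √(n / (ε * √m))) ≤ A.expectedQueries μ G := by
  rcases m.eq_zero_or_pos with rfl | hm₀
  · exact ⟨⊥, by simp, by simp⟩
  set c := √(1 - ε) / 1000 * min √m √(n / (ε * √m)) with hc
  have hfloor : ENNReal.ofReal (√(1 - ε) / 4000 * min √m √(n / (ε * √m))) ≤
      ((⌊c⌋₊ : ℝ≥0∞) + 1) / 4 := by
    refine ENNReal.ofReal_le_of_le_toReal ?_
    have hlt := Nat.lt_floor_add_one c
    have htoReal : (((⌊c⌋₊ : ℝ≥0∞) + 1) / 4).toReal = (⌊c⌋₊ + 1) / 4 := by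
      rw [ENNReal.toReal_div, ENNReal.toReal_add (by finiteness) (by finiteness)]
      simp
    linarith
  suffices ∃ G : SimpleGraph (Fin n), G.edgeSet.ncard = m ∧
      ((⌊c⌋₊ : ℝ≥0∞) + 1) / 4 ≤ A.expectedQueries μ G from
    this.imp fun _ hG => hG.imp_right hfloor.trans
  rcases Nat.eq_zero_or_pos ⌊c⌋₊ with hq | hq
  · simpa [hq] using hA.exists_one_fourth_le_expectedQueries hε' hm₀ hm
  obtain ⟨k, h⟩ := exists_admissible hε hε' hm₀ hq (Nat.floor_le (by positivity))
  rcases lt_or_ge n (6 * (k + 1)) with hn | hn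
  · exact h.exists_le_expectedQueries_of_dense hA hm hn
  · exact h.exists_le_expectedQueries_of_sparse hA hn

end Estimation

end Parameters

end HybridModel

theorem mainTheorem3 (ε₀ : ℝ) (hε₀ : ε₀ < 1) :
    ∃ c : ℝ, 0 < c ∧
      ∀ (ε : ℝ), 0 < ε → ε ≤ ε₀ →
      ∀ (n : ℕ) {Ω : Type*} [MeasurableSpace Ω] (μ : MeasureTheory.Measure Ω)
        [MeasureTheory.IsProbabilityMeasure μ] (A : HybridModel.RandAlg n Ω),
        A.EstimatesEdges μ ε →
        ∀ m : ℕ, m ≤ n.choose 2 →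
          ∃ G : SimpleGraph (Fin n), G.edgeSet.ncard = m ∧
            ENNReal.ofReal (c * min (√(m : ℝ)) (√((n : ℝ) / (ε * √(m : ℝ)))))
              ≤ A.expectedQueries μ G := by
  have : 0 < 1 - ε₀ := sub_pos.mpr hε₀
  refine ⟨√(1 - ε₀) / 4000, by positivity, fun ε hε hεε₀ n Ω _ μ _ A hA m hm => ?_⟩
  obtain ⟨G, hG, hle⟩ :=
    hA.exists_sqrt_mul_min_le_expectedQueries hε (hεε₀.trans_lt hε₀) hm
  exact ⟨G, hG, (ENNReal.ofReal_le_ofReal (by gcongr)).trans hle⟩
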